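/- **Setting.** Let $\mathbb K$ be a field, $m,n\ge 1$, $\underline s=s_1,\dots,s_m$, $\underline x=x_1,\dots,x_n$, $\underline\partial=\partial_{x_1},\dots,\partial_{x_n}$. Let $\underline F=F_1,\dots,F_r\in\mathbb K[\![\underline s,\underline x]\!]\langle\underline\partial\rangle$ be differential operators of the form $\underline F=\underline f-\underline sD$ with $\underline f=f_1,\dots,f_r\in\mathbb K[\![\underline x]\!]$ and $D=(\underline d^j)_j\in\mathbb K[\![\underline s,\underline x]\!]\langle\underline\partial\rangle^{m\times r}$, where $\langle\underline x\rangle^k\subset\langle\underline f\rangle\mathbb K[\![\underline x]\!]$ for some $k\ge0$. Let $\langle\underline F\rangle\mathbb K[\![\underline s,\underline x]\!]$ be the image of the $\mathbb K[\![\underline s]\!]$-linear map $\mathbb K[\![\underline s,\underline x]\!]^r\to\mathbb K[\![\underline s,\underline x]\!]$, $\overline q\mapsto\sum_iF_i(q^i)$, and let $\pi_H:\mathbb K[\![\underline s,\underline x]\!]\to H=\mathbb K[\![\underline s,\underline x]\!]/\langle\underline F\rangle\mathbb K[\![\underline s,\underline x]\!]$ be the projection onto its cokernel. Let $<_{\underline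 x}$ and $<_{\underline s}$ be local degree orderings on the monomials in $\underline x$ and in $\underline s$, i.e. total semigroup orderings refining weighted degrees $\deg_{\underline x}$, $\deg_{\underline s}$ (additive, $\mathbb Q$-valued, negative on every variable) in the sense that a monomial of smaller degree is smaller. Let $<=(<_{\underline s},<_{\underline x})$ be the block ordering ($<_{\underline s}$ is compared first), $\deg=\deg_{\underline s}+\deg_{\underline x}$, and $\deg(\partial_{x_i})=-\deg(x_i)$; the degree of a power series or an operator is the maximal degree of its terms. Leading terms $\mathrm{lead}$ are the greatest terms with respect to $<_{\underline x}$ on $\mathbb K[\![\underline x]\!]$ and $<$ on $\mathbb K[\![\underline s,\underline x]\!]$, and $\mathrm{lead}_{\underline s}(p)=p_\alpha\underline s^\alpha$ for $p=\sum_\alpha p_\alpha\underline s^\alpha$, $p_\alpha\in\mathbb K[\![\underline x]\!]$, where $\underline s^\alpha$ is the $<_{\underline s}$-greatest monomial with $p_\alpha\ne0$. Let $\underline g=g_1,\dots,g_l$ be a standard basis of $\langle\underline f\rangle\mathbb K[\![\underline x]\!]$ (nonzero elements of this ideal whose leading terms generate its leading ideal), let $\underline m$ be the family of monomials $\underline x^\beta\notin\langle\mathrm{lead}(\underline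 g)\rangle$, and let $U$ be a matrix over $\mathbb K[\![\underline x]\!]$ with $\underline g=\underline fU$; put $\underline G=G_1,\dots,G_l=\underline FU$. Assume that $\deg(s_j)\le\min\deg(\underline m)+\min\deg(\underline x)-\max\deg(\underline d^j)$ for all $j$ (no condition if $\underline m$ is empty or $\underline d^j=0$), and put $N_K=-K\min\deg(\underline s)-\min\deg(\underline x)+\max\deg(D)$ for integers $K\le0$ (with $\max\deg(D)$ read as $0$ if $D=0$). For $p\in\mathbb K[\![\underline s,\underline x]\!]$ and $K\le 0$ the recursive procedure $\mathrm{NF}(p,K)$ returns a triple in $\mathbb K[\![\underline s,\underline x]\!]\times\mathbb K[\![\underline s,\underline x]\!]^l\times\mathbb K[\![\underline s,\underline x]\!]$ as follows. Let $q=p$ if $p\in\langle\underline s\rangle^{-K}$; otherwise let $q=\mathrm{lead}_{\underline s}(p)$ if $\deg\mathrm{lead}(p)<N_K$ or $\mathrm{lead}_{\underline s}(p)\in\langle\underline s\rangle^{-K}$; otherwise let $q=0$. Let $\rho=p-q$. If $\rho=0$, return $(0,\overline 0,q)$. If some $\mathrm{lead}(g_j)$ divides $\mathrm{lead}(\rho)$,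 take $j$ minimal, let $t=\mathrm{lead}(\rho)/\mathrm{lead}(g_j)$ and $(r',\overline a',q')=\mathrm{NF}(\rho-G_j(t),K)$, and return $(r',\overline a'+t\,\overline e_j,q+q')$. Otherwise let $(r',\overline a',q')=\mathrm{NF}(\rho-\mathrm{lead}(\rho),K)$ and return $(\mathrm{lead}(\rho)+r',\overline a',q+q')$. Fix a strictly decreasing sequence $(K_i)_{i\ge0}$ of integers $K_i\le0$. The limit normal form of $p$ is $(\mathrm{NF}_1(p),\mathrm{NF}_2(p))=\bigl(\sum_{i\ge0}r_i,\sum_{i\ge0}\overline a_i\bigr)$ in the $\langle\underline s,\underline x\rangle$-adic topology, where $p_0=p$ and $(r_i,\overline a_i,p_{i+1})=\mathrm{NF}(p_i,K_i)$. **Proposition.** The limit normal form is well defined for every $p\in\mathbb K[\![\underline s,\underline x]\!]$ (all the calls of $\mathrm{NF}$ terminate and the series converge), and $\mathrm{NF}_1$ is a $\mathbb K[\![\underline s]\!]$-linear map from $\mathbb K[\![\underline s,\underline x]\!]$ onto $\langle\underline m\rangle\mathbb K[\![\underline s]\!]$ with $\mathrm{NF}_1^2=\mathrm{NF}_1$ and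 $\pi_H\circ\mathrm{NF}_1=\pi_H$; both $\pi_H$ and its restriction to $\langle\underline m\rangle\mathbb K[\![\underline s]\!]$ are onto $H$. In particular, if $H$ is a free $\mathbb K[\![\underline s]\!]$-module, then $\mathrm{NF}_1$ factors through $\pi_H$ and induces a $\mathbb K[\![\underline s]\!]$-linear section $H\to\mathbb K[\![\underline s,\underline x]\!]$ of $\pi_H$ with image $\langle\underline m\rangle\mathbb K[\![\underline s]\!]$. It is the $\underline m$-basis representation: the classes of the members of $\underline m$ form a $\mathbb K[\![\underline s]\!]$-basis of $H$, and the section maps $\sum_{\underline x^\beta\in\underline m}c_\beta\,\pi_H(\underline x^\beta)$ to $\sum_{\underline x^\beta\in\underline m}c_\beta\,\underline x^\beta$. -/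

import Mathlib

open scoped Classical in
/-- The greatest element of `S` with respect to the strict order `lt`,
and `0` if `S` has no greatest element. -/
noncomputable def greatest {α : Type*} [Zero α] (lt : α → α → Prop) (S : Set α) : α :=
  if h : ∃ e ∈ S, ∀ e' ∈ S, e' ≠ e → lt e' e then h.choose else 0

/-- A local degree ordering on the monomials (exponent vectors) in `n` variables, with respect to
a weighted degree `ℕⁿ → ℚ` that is negative on every variable: a strict total order that is
compatible with addition of exponents and that is refined from the weighted degree. -/
structure LocalDegreeOrder (n : ℕ) where
  wt : Fin n → ℚ
  wt_neg : ∀ i, wt i < 0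
  lt : (Fin n →₀ ℕ) → (Fin n →₀ ℕ) → Prop
  strictTotal : IsStrictTotalOrder (Fin n →₀ ℕ) lt
  add_right : ∀ a b c, lt a b → lt (a + c) (b + c)
  lt_of_deg_lt : ∀ a b : Fin n →₀ ℕ,
    (∑ i, (a i : ℚ) * wt i) < (∑ i, (b i : ℚ) * wt i) → lt a b

/-- The weighted degree of a monomial. -/
def LocalDegreeOrder.deg {n : ℕ} (o : LocalDegreeOrder n) (a : Fin n →₀ ℕ) : ℚ :=
  ∑ i, (a i : ℚ) * o.wt i

namespace LocalDegreeOrder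

variable {𝕜 : Type*} [Field 𝕜] {n : ℕ}

/-- Leading exponent of a power series in `x` (the value at the zero series is irrelevant). -/
noncomputable def lexp (o : LocalDegreeOrder n) (p : MvPowerSeries (Fin n) 𝕜) : Fin n →₀ ℕ :=
  greatest o.lt {a | MvPowerSeries.coeff a p ≠ 0}

/-- Leading term of a power series in `x`; it is `0` for the zero series. -/
noncomputable def lead (o : LocalDegreeOrder n) (p : MvPowerSeries (Fin n) 𝕜) :
    MvPowerSeries (Fin n) 𝕜 :=
  MvPowerSeries.monomial (o.lexp p) (MvPowerSeries.coeff (o.lexp p) p)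

end LocalDegreeOrder

/-- `g` is a standard basis of the ideal `I` of `𝕜[[x]]`: its members are nonzero elements of `I`
and their leading terms generate the ideal generated by all leading terms of elements of `I`. -/
def IsStandardBasis {𝕜 : Type*} [Field 𝕜] {n l : ℕ} (o : LocalDegreeOrder n)
    (I : Ideal (MvPowerSeries (Fin n) 𝕜)) (g : Fin l → MvPowerSeries (Fin n) 𝕜) : Prop :=
  (∀ k, g k ≠ 0) ∧ (∀ k, g k ∈ I) ∧
    Ideal.span (o.lead '' (I : Set (MvPowerSeries (Fin n) 𝕜))) =
      Ideal.span (Set.range fun k => o.lead (g k))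

/-- The exponents of the monomials in `x` outside the leading ideal of `g`,
i.e. the exponents of the members of the monomial family `m`. -/
def stdExponents {𝕜 : Type*} [Field 𝕜] {n l : ℕ} (o : LocalDegreeOrder n)
    (g : Fin l → MvPowerSeries (Fin n) 𝕜) : Set (Fin n →₀ ℕ) :=
  {b | (MvPowerSeries.monomial b (1 : 𝕜)) ∉ Ideal.span (Set.range fun k => o.lead (g k))}

/-- The ring `𝕜[[s]]` of formal power series in the parameters `s_1, …, s_m`. -/
abbrev SRing (𝕜 : Type*) [Field 𝕜] (m : ℕ) := MvPowerSeries (Fin m) 𝕜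

/-- The ring `𝕜[[s,x]] = 𝕜[[s]][[x]]` with its structure of `𝕜[[s]]`-algebra.
The coefficient of `s^a x^b` in `p` is `coeff a (coeff b p)`. -/
abbrev SXRing (𝕜 : Type*) [Field 𝕜] (m n : ℕ) := MvPowerSeries (Fin n) (SRing 𝕜 m)

/-- Differential operators `∑_γ p_γ ∂^γ` with coefficients `p_γ ∈ 𝕜[[s,x]]`, polynomial in
`∂ = ∂_{x_1}, …, ∂_{x_n}`, written with coefficients on the left. -/
abbrev DiffOp (𝕜 : Type*) [Field 𝕜] (m n : ℕ) := (Fin n →₀ ℕ) →₀ SXRing 𝕜 m n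

section Family

variable {𝕜 : Type*} [Field 𝕜] {m n r l : ℕ}

/-- The inclusion `𝕜[[x]] → 𝕜[[s,x]]`. -/
noncomputable def ofX (𝕜 : Type*) [Field 𝕜] (m n : ℕ) :
    MvPowerSeries (Fin n) 𝕜 →+* SXRing 𝕜 m n :=
  MvPowerSeries.map (MvPowerSeries.C (σ := Fin m) (R := 𝕜))

/-- The parameter `s_j` as an element of `𝕜[[s,x]]`. -/
noncomputable def sVar (𝕜 : Type*) [Field 𝕜] (m n : ℕ) (j : Fin m) : SXRing 𝕜 m n :=
  MvPowerSeries.C (MvPowerSeries.X j)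

/-- The variable `x_i` as an element of `𝕜[[s,x]]`. -/
noncomputable def xVar (𝕜 : Type*) [Field 𝕜] (m n : ℕ) (i : Fin n) : SXRing 𝕜 m n :=
  MvPowerSeries.X i

/-- The ideal `⟨s⟩` of `𝕜[[s,x]]`. -/
noncomputable def sIdeal (𝕜 : Type*) [Field 𝕜] (m n : ℕ) : Ideal (SXRing 𝕜 m n) :=
  Ideal.span (Set.range (sVar 𝕜 m n))

/-- The ideal `⟨s,x⟩` of `𝕜[[s,x]]`. -/
noncomputable def sxIdeal (𝕜 : Type*) [Field 𝕜] (m n : ℕ) : Ideal (SXRing 𝕜 m n) :=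
  Ideal.span (Set.range (sVar 𝕜 m n) ∪ Set.range (xVar 𝕜 m n))

/-- The operator `∂^γ = ∂_1^{γ_1} ⋯ ∂_n^{γ_n}` on `𝕜[[s,x]]` (the `∂_i` commute). -/
noncomputable def partialPow (𝕜 : Type*) [Field 𝕜] (m n : ℕ) (γ : Fin n →₀ ℕ) :
    Module.End (SRing 𝕜 m) (SXRing 𝕜 m n) :=
  ((List.finRange n).map fun i =>
    ((MvPowerSeries.pderiv (SRing 𝕜 m) i).toLinearMap :
      Module.End (SRing 𝕜 m) (SXRing 𝕜 m n)) ^ (γ i)).prod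

/-- The `𝕜[[s]]`-linear action of a differential operator on `𝕜[[s,x]]`. -/
noncomputable def DiffOp.act (P : DiffOp 𝕜 m n) : SXRing 𝕜 m n →ₗ[SRing 𝕜 m] SXRing 𝕜 m n :=
  P.sum fun γ c => (LinearMap.mulLeft (SRing 𝕜 m) c) ∘ₗ partialPow 𝕜 m n γ

/-- A power series in `x` as a differential operator of order zero. -/
noncomputable def DiffOp.ofSeries (m : ℕ) {n : ℕ} (p : MvPowerSeries (Fin n) 𝕜) : DiffOp 𝕜 m n :=
  Finsupp.single 0 (ofX 𝕜 m n p)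

/-- The `𝕜[[s]]`-linear map `F : 𝕜[[s,x]]^r → 𝕜[[s,x]]`, `q ↦ ∑ F_i q_i`. -/
noncomputable def familyMap (F : Fin r → DiffOp 𝕜 m n) :
    (Fin r → SXRing 𝕜 m n) →ₗ[SRing 𝕜 m] SXRing 𝕜 m n :=
  ∑ i, (F i).act ∘ₗ LinearMap.proj i

/-- The `𝕜[[s]]`-module `H = 𝕜[[s,x]] / ⟨F⟩𝕜[[s,x]]`, the cokernel of `F`. -/
abbrev Coker (F : Fin r → DiffOp 𝕜 m n) := SXRing 𝕜 m n ⧸ LinearMap.range (familyMap F)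

/-- The canonical projection `π_H : 𝕜[[s,x]] → H`. -/
noncomputable def cokerProj (F : Fin r → DiffOp 𝕜 m n) :
    SXRing 𝕜 m n →ₗ[SRing 𝕜 m] Coker F :=
  (LinearMap.range (familyMap F)).mkQ

/-- The element `G_k = ∑ F_i U_{ik}` of the partial standard basis `G = F U`,
as an operator on `𝕜[[s,x]]`. -/
noncomputable def partialBasis (F : Fin r → DiffOp 𝕜 m n)
    (U : Matrix (Fin r) (Fin l) (MvPowerSeries (Fin n) 𝕜)) (k : Fin l) :
    SXRing 𝕜 m n →ₗ[SRing 𝕜 m] SXRing 𝕜 m n :=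
  ∑ i, (F i).act ∘ₗ LinearMap.mulLeft (SRing 𝕜 m) (ofX 𝕜 m n (U i k))

/-- The monomial `x^b` in `𝕜[[s,x]]`. -/
noncomputable def xMonomial (𝕜 : Type*) [Field 𝕜] (m : ℕ) {n : ℕ} (b : Fin n →₀ ℕ) :
    SXRing 𝕜 m n :=
  MvPowerSeries.monomial b 1

/-- The `𝕜[[s]]`-submodule `⟨m⟩𝕜[[s]]` of `𝕜[[s,x]]` generated by the monomial family `m`. -/
noncomputable def monomialSpan (m : ℕ) (ox : LocalDegreeOrder n)
    (g : Fin l → MvPowerSeries (Fin n) 𝕜) : Submodule (SRing 𝕜 m) (SXRing 𝕜 m n) :=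
  Submodule.span (SRing 𝕜 m) (xMonomial 𝕜 m '' stdExponents ox g)

/-- The block ordering `(<_s, <_x)` on the monomials `s^a x^b`. -/
def blockLt (os : LocalDegreeOrder m) (ox : LocalDegreeOrder n)
    (e e' : (Fin m →₀ ℕ) × (Fin n →₀ ℕ)) : Prop :=
  os.lt e.1 e'.1 ∨ (e.1 = e'.1 ∧ ox.lt e.2 e'.2)

/-- The exponents of the monomials occurring in a power series in `s, x`. -/
def sxSupport (p : SXRing 𝕜 m n) : Set ((Fin m →₀ ℕ) × (Fin n →₀ ℕ)) :=
  {e | MvPowerSeries.coeff e.1 (MvPowerSeries.coeff e.2 p) ≠ 0}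

/-- Leading exponent with respect to the block ordering (irrelevant at the zero series). -/
noncomputable def sxLexp (os : LocalDegreeOrder m) (ox : LocalDegreeOrder n)
    (p : SXRing 𝕜 m n) : (Fin m →₀ ℕ) × (Fin n →₀ ℕ) :=
  greatest (blockLt os ox) (sxSupport p)

/-- Leading term with respect to the block ordering; it is `0` for the zero series. -/
noncomputable def sxLead (os : LocalDegreeOrder m) (ox : LocalDegreeOrder n)
    (p : SXRing 𝕜 m n) : SXRing 𝕜 m n :=
  MvPowerSeries.monomial (sxLexp os ox p).2 (MvPowerSeries.monomial (sxLexp os ox p).1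
    (MvPowerSeries.coeff (sxLexp os ox p).1 (MvPowerSeries.coeff (sxLexp os ox p).2 p)))

/-- Leading exponent with respect to `<_s` (irrelevant at the zero series). -/
noncomputable def sLexp (os : LocalDegreeOrder m) (p : SXRing 𝕜 m n) : Fin m →₀ ℕ :=
  greatest os.lt (Prod.fst '' sxSupport p)

/-- Leading term `p_a s^a`, `p_a ∈ 𝕜[[x]]`, with respect to `<_s`. -/
noncomputable def sLead (os : LocalDegreeOrder m) (p : SXRing 𝕜 m n) : SXRing 𝕜 m n :=
  fun b => MvPowerSeries.monomial (sLexp os p)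
    (MvPowerSeries.coeff (sLexp os p) (MvPowerSeries.coeff b p))

/-- The weighted degrees `deg_s(s^a) + deg_x(x^b) - deg_x(x^γ)` of the terms `s^a x^b ∂^γ`
that occur in a differential operator. -/
def DiffOp.degrees (os : LocalDegreeOrder m) (ox : LocalDegreeOrder n) (P : DiffOp 𝕜 m n) :
    Set ℚ :=
  {d | ∃ (γ : Fin n →₀ ℕ) (e : (Fin m →₀ ℕ) × (Fin n →₀ ℕ)),
    e ∈ sxSupport (P γ) ∧ d = os.deg e.1 + ox.deg e.2 - ox.deg γ}

/-- The condition `deg(s_j) ≤ min deg(m) + min deg(x) - max deg(d^j)` for every row `d^j` of `D`. -/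
def DegreeCondition (os : LocalDegreeOrder m) (ox : LocalDegreeOrder n)
    (g : Fin l → MvPowerSeries (Fin n) 𝕜) (D : Fin m → Fin r → DiffOp 𝕜 m n) : Prop :=
  ∀ j, ∀ b ∈ stdExponents ox g, ∀ i : Fin n, ∀ k : Fin r, ∀ d ∈ (D j k).degrees os ox,
    os.wt j ≤ ox.deg b + ox.wt i - d

/-- The smallest weight `min deg` of the variables. -/
def LocalDegreeOrder.minWt [NeZero n] (o : LocalDegreeOrder n) : ℚ :=
  Finset.univ.inf' Finset.univ_nonempty o.wt

/-- The bounds `N_K = -K min deg(s) - min deg(x) + max deg(D)`, where the last summand is read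
as `0` if `D = 0`. -/
noncomputable def degBound [NeZero m] [NeZero n] (os : LocalDegreeOrder m)
    (ox : LocalDegreeOrder n) (D : Fin m → Fin r → DiffOp 𝕜 m n) (K : ℤ) : ℚ :=
  -(K : ℚ) * os.minWt - ox.minWt + greatest (· < ·) (⋃ j, ⋃ k, (D j k).degrees os ox)

open scoped Classical in
/-- The part `q` of `p` that one step of the normal form algorithm for the bound `K ≤ 0`
splits off; `N` is the sequence of degree bounds. -/
noncomputable def cutoff (os : LocalDegreeOrder m) (ox : LocalDegreeOrder n) (N : ℤ → ℚ)
    (p : SXRing 𝕜 m n) (K : ℤ) : SXRing 𝕜 m n :=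
  if p ∈ sIdeal 𝕜 m n ^ (-K).toNat then p
  else if os.deg (sxLexp os ox p).1 + ox.deg (sxLexp os ox p).2 < N K ∨
      sLead os p ∈ sIdeal 𝕜 m n ^ (-K).toNat then sLead os p
  else 0

/-- The recursive normal form algorithm as an input-output relation: `NFRun os ox F g U N K p R a q`
says that the call `NF(p, K)` terminates and returns `(R, a, q)`. -/
inductive NFRun (os : LocalDegreeOrder m) (ox : LocalDegreeOrder n) (F : Fin r → DiffOp 𝕜 m n)
    (g : Fin l → MvPowerSeries (Fin n) 𝕜)
    (U : Matrix (Fin r) (Fin l) (MvPowerSeries (Fin n) 𝕜)) (N : ℤ → ℚ) (K : ℤ) :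
    SXRing 𝕜 m n → SXRing 𝕜 m n → (Fin l → SXRing 𝕜 m n) → SXRing 𝕜 m n → Prop
  /-- Nothing is left after splitting off `q`. -/
  | done (p : SXRing 𝕜 m n) (h : p - cutoff os ox N p K = 0) :
      NFRun os ox F g U N K p 0 0 (cutoff os ox N p K)
  /-- The leading term of `ρ = p - q` is `lead(g_k) t` with `k` minimal: reduce by `G_k t`. -/
  | reduce (p ρ : SXRing 𝕜 m n) (hρ : ρ = p - cutoff os ox N p K) (h : ρ ≠ 0)
      (k : Fin l) (t : SXRing 𝕜 m n) (ht : sxLead os ox ρ = ofX 𝕜 m n (ox.lead (g k)) * t)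
      (hk : ∀ k' < k, ¬ ofX 𝕜 m n (ox.lead (g k')) ∣ sxLead os ox ρ)
      (R : SXRing 𝕜 m n) (a : Fin l → SXRing 𝕜 m n) (q : SXRing 𝕜 m n)
      (hrec : NFRun os ox F g U N K (ρ - partialBasis F U k t) R a q) :
      NFRun os ox F g U N K p R (a + Pi.single k t) (cutoff os ox N p K + q)
  /-- The leading term of `ρ = p - q` is not reducible: move it to the remainder. -/
  | keep (p ρ : SXRing 𝕜 m n) (hρ : ρ = p - cutoff os ox N p K) (h : ρ ≠ 0)
      (hk : ∀ k, ¬ ofX 𝕜 m n (ox.lead (g k)) ∣ sxLead os ox ρ)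
      (R : SXRing 𝕜 m n) (a : Fin l → SXRing 𝕜 m n) (q : SXRing 𝕜 m n)
      (hrec : NFRun os ox F g U N K (ρ - sxLead os ox ρ) R a q) :
      NFRun os ox F g U N K p (sxLead os ox ρ + R) a (cutoff os ox N p K + q)

/-- The series `∑ u_i` converges to `v` in the `⟨s,x⟩`-adic topology of `𝕜[[s,x]]`. -/
def AdicHasSum (u : ℕ → SXRing 𝕜 m n) (v : SXRing 𝕜 m n) : Prop :=
  ∀ d : ℕ, ∃ M : ℕ, ∀ k ≥ M, v - ∑ i ∈ Finset.range k, u i ∈ sxIdeal 𝕜 m n ^ d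

/-- The limit normal form along the sequence `K`: `LimitNF os ox F g U N K p R a` says that
`NF(p) = (R, a) = (∑ R_i, ∑ a_i)`, where `p_0 = p` and `(R_i, a_i, p_{i+1}) = NF(p_i, K_i)`. -/
def LimitNF (os : LocalDegreeOrder m) (ox : LocalDegreeOrder n) (F : Fin r → DiffOp 𝕜 m n)
    (g : Fin l → MvPowerSeries (Fin n) 𝕜)
    (U : Matrix (Fin r) (Fin l) (MvPowerSeries (Fin n) 𝕜)) (N : ℤ → ℚ) (K : ℕ → ℤ)
    (p R : SXRing 𝕜 m n) (a : Fin l → SXRing 𝕜 m n) : Prop :=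
  ∃ (P Rs : ℕ → SXRing 𝕜 m n) (as : ℕ → Fin l → SXRing 𝕜 m n),
    P 0 = p ∧ (∀ i, NFRun os ox F g U N (K i) (P i) (Rs i) (as i) (P (i + 1))) ∧
    AdicHasSum Rs R ∧ ∀ k, AdicHasSum (fun i => as i k) (a k)

end Family

/-! The core is that division with remainder by the operators `G_k` is a bijection. The pairs `(a,
R)` satisfying the divisibility conditions of a division by `g` form the module `divisionPairs`;
these conditions only involve exponents of `x`, so it is stable under `𝕜[[s]]`. The map `Φ : (a, R)
↦ ∑ G_k a_k + R` is shown to be a `𝕜[[s]]`-linear isomorphism from this module onto `𝕜[[s,x]]`. The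
limit normal form computes `Φ⁻¹`, and `NF₁` is the second component of `Φ⁻¹`. Uniqueness, linearity
and idempotence follow at once, although the algorithm itself is not visibly linear.

Injectivity (`eq_zero_of_divisionMap_eq_zero`): `G_k` is multiplication by `g_k` plus terms that
strictly raise the exponent of `s` (`IsPerturbation`). Such terms are smaller in the block ordering,
so `G_k a_k` has the leading monomial of `lead(g_k) a_k`. The divisibility conditions prevent the
leading monomials of distinct summands from cancelling.

Surjectivity is existence of the limit normal form. A single call terminates (`NFRun.exists_run`)
because only finitely many monomials lie above the cutoff bounds. The limit converges
(`eventually_mem_sxIdeal_pow`) by a bound `deg(x^b) ≤ δ + C |a|` on all terms `s^a x^b`. Derivatives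
raise the degree in `x` by a bounded amount, but each comes with at least one factor `s_j`, so a
large slope `C` makes the bound stable under reduction. What a call with bound `K_i` leaves over
satisfies it with `δ → -∞`.

Since each `G_k` maps into the image of `F`, `NF₁` does not change classes in `H`, and the standard
monomials generate `H`. At `s = 0`, a relation between their classes becomes an element of `⟨f⟩`
supported on standard monomials, hence zero; so all relations have coefficients in the maximal
ideal. If `H` is free, the presentation splits and Nakayama's lemma removes the relations. Then
`NF₁` kills the image of `F` and descends to `H`. -/

section Coefficients

/-! ### Coefficients, powers of the ideals ⟨s⟩ and ⟨s,x⟩, and adic convergence. -/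

variable {𝕜 : Type*} [Field 𝕜] {m n : ℕ}

/-- The coefficient of the monomial `s^a x^b` in a power series in `s, x`. -/
noncomputable def sxCoeff (e : (Fin m →₀ ℕ) × (Fin n →₀ ℕ)) : SXRing 𝕜 m n →+ 𝕜 :=
  (MvPowerSeries.coeff (R := 𝕜) e.1).toAddMonoidHom.comp
    (MvPowerSeries.coeff (R := SRing 𝕜 m) e.2).toAddMonoidHom

theorem sxCoeff_apply (e : (Fin m →₀ ℕ) × (Fin n →₀ ℕ)) (p : SXRing 𝕜 m n) :
    sxCoeff e p = MvPowerSeries.coeff e.1 (MvPowerSeries.coeff e.2 p) := rfl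

theorem mem_sxSupport {e : (Fin m →₀ ℕ) × (Fin n →₀ ℕ)} {p : SXRing 𝕜 m n} :
    e ∈ sxSupport p ↔ sxCoeff e p ≠ 0 := Iff.rfl

theorem notMem_sxSupport_zero (e : (Fin m →₀ ℕ) × (Fin n →₀ ℕ)) :
    e ∉ sxSupport (0 : SXRing 𝕜 m n) := fun h => h (map_zero (sxCoeff e))

theorem mem_or_mem_of_mem_sxSupport_add {p q : SXRing 𝕜 m n} {e} (h : e ∈ sxSupport (p + q)) :
    e ∈ sxSupport p ∨ e ∈ sxSupport q := by
  by_contra! h'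
  simp only [mem_sxSupport, not_not] at h h'
  exact h ((map_add (sxCoeff e) p q).trans (by rw [h'.1, h'.2, add_zero]))

/-- Scalars from `𝕜[[s]]` create no new exponents of `x`. This makes `divisionPairs` a
`𝕜[[s]]`-submodule. -/
theorem exists_of_mem_sxSupport_smul {c : SRing 𝕜 m} {p : SXRing 𝕜 m n} {e}
    (h : e ∈ sxSupport (c • p)) : ∃ a, (a, e.2) ∈ sxSupport p := by
  by_contra! h'
  refine h ?_
  rw [MvPowerSeries.coeff_smul, show MvPowerSeries.coeff e.2 p = 0 from
    MvPowerSeries.ext fun a => not_not.1 (h' a), mul_zero, map_zero]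

theorem sx_ext {p q : SXRing 𝕜 m n} (h : ∀ e, sxCoeff e p = sxCoeff e q) : p = q :=
  MvPowerSeries.ext fun b => MvPowerSeries.ext fun a => h (a, b)

/-- The power series in `s, x` with prescribed coefficients. -/
def sxMk (φ : (Fin m →₀ ℕ) × (Fin n →₀ ℕ) → 𝕜) : SXRing 𝕜 m n := fun b a => φ (a, b)

theorem sxCoeff_sxMk (φ : (Fin m →₀ ℕ) × (Fin n →₀ ℕ) → 𝕜) (e) : sxCoeff e (sxMk φ) = φ e := rfl

theorem exists_sxCoeff_ne_zero {p : SXRing 𝕜 m n} (h : p ≠ 0) : (sxSupport p).Nonempty := by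
  by_contra hne
  refine h (sx_ext fun e => ?_)
  by_contra he
  exact hne ⟨e, by simpa [mem_sxSupport] using he⟩

theorem exists_of_sxCoeff_mul_ne_zero {p q : SXRing 𝕜 m n} {e}
    (h : sxCoeff e (p * q) ≠ 0) : ∃ u v, u + v = e ∧ sxCoeff u p ≠ 0 ∧ sxCoeff v q ≠ 0 := by
  classical
  rw [sxCoeff_apply, MvPowerSeries.coeff_mul, map_sum] at h
  obtain ⟨b, hb, h⟩ := Finset.exists_ne_zero_of_sum_ne_zero h
  rw [MvPowerSeries.coeff_mul] at h
  obtain ⟨a, ha, h⟩ := Finset.exists_ne_zero_of_sum_ne_zero h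
  rw [Finset.HasAntidiagonal.mem_antidiagonal] at ha hb
  exact ⟨(a.1, b.1), (a.2, b.2), Prod.ext ha hb, left_ne_zero_of_mul h, right_ne_zero_of_mul h⟩

theorem sxCoeff_ofX_mul (g : MvPowerSeries (Fin n) 𝕜) (p : SXRing 𝕜 m n) (e) :
    sxCoeff e (ofX 𝕜 m n g * p) =
      ∑ w ∈ Finset.HasAntidiagonal.antidiagonal e.2, MvPowerSeries.coeff w.1 g * sxCoeff (e.1, w.2) p := by
  classical
  rw [sxCoeff_apply, MvPowerSeries.coeff_mul, map_sum]
  refine Finset.sum_congr rfl fun w _ => ?_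
  rw [ofX, MvPowerSeries.coeff_map, MvPowerSeries.coeff_C_mul, sxCoeff_apply]

theorem exists_of_sxCoeff_ofX_mul_ne_zero {g : MvPowerSeries (Fin n) 𝕜} {p : SXRing 𝕜 m n} {e}
    (h : sxCoeff e (ofX 𝕜 m n g * p) ≠ 0) :
    ∃ u b, u + b = e.2 ∧ MvPowerSeries.coeff u g ≠ 0 ∧ sxCoeff (e.1, b) p ≠ 0 := by
  rw [sxCoeff_ofX_mul] at h
  obtain ⟨w, hw, h⟩ := Finset.exists_ne_zero_of_sum_ne_zero h
  exact ⟨w.1, w.2, by simpa using hw, left_ne_zero_of_mul h, right_ne_zero_of_mul h⟩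

theorem sxCoeff_sVar_mul (j : Fin m) (p : SXRing 𝕜 m n) (e) :
    sxCoeff e (sVar 𝕜 m n j * p) =
      if (Finsupp.single j 1, 0) ≤ e then sxCoeff (e - (Finsupp.single j 1, 0)) p else 0 := by
  classical
  rw [sxCoeff_apply, sVar, MvPowerSeries.coeff_C_mul, MvPowerSeries.X,
    MvPowerSeries.coeff_monomial_mul, sxCoeff_apply]
  simp [Prod.le_def]

theorem sxCoeff_xVar_mul (j : Fin n) (p : SXRing 𝕜 m n) (e) :
    sxCoeff e (xVar 𝕜 m n j * p) =
      if (0, Finsupp.single j 1) ≤ e then sxCoeff (e - (0, Finsupp.single j 1)) p else 0 := by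
  classical
  rw [sxCoeff_apply, xVar, MvPowerSeries.X, MvPowerSeries.coeff_monomial_mul]
  split_ifs <;> simp_all [Prod.le_def, sxCoeff_apply]

/-- Treats `⟨s⟩` and `⟨s,x⟩` together: each `v i` acts as the shift by `δ i`, and `d` counts the
variables concerned. It turns membership in a power into a condition on coefficients. -/
theorem mem_span_range_pow_iff {ι : Type*} [Fintype ι] {v : ι → SXRing 𝕜 m n}
    {δ : ι → (Fin m →₀ ℕ) × (Fin n →₀ ℕ)} (d : (Fin m →₀ ℕ) × (Fin n →₀ ℕ) →+ ℕ)
    (hv : ∀ i p e, sxCoeff e (v i * p) = if δ i ≤ e then sxCoeff (e - δ i) p else 0)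
    (hδ : ∀ i, d (δ i) = 1) (hd : ∀ e, d e ≠ 0 → ∃ i, δ i ≤ e) (k : ℕ) (p : SXRing 𝕜 m n) :
    p ∈ Ideal.span (Set.range v) ^ k ↔ ∀ e, d e < k → sxCoeff e p = 0 := by
  classical
  let J : ℕ → Ideal (SXRing 𝕜 m n) := fun k =>
    { carrier := {p | ∀ e, d e < k → sxCoeff e p = 0}
      add_mem' := fun {p q} hp hq e he => by rw [map_add, hp e he, hq e he, add_zero]
      zero_mem' := fun e _ => map_zero _
      smul_mem' := fun c p hp e he => by
        by_contra h
        obtain ⟨u, w, huw, -, hw⟩ := exists_of_sxCoeff_mul_ne_zero h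
        refine hw (hp w ?_)
        rw [← huw, map_add] at he
        omega }
  have hle : ∀ {i e}, δ i ≤ e → d (e - δ i) + 1 = d e := fun {i e} h => by
    rw [← hδ i, ← map_add, tsub_add_cancel_of_le h]
  constructor
  · suffices h : Ideal.span (Set.range v) ^ k ≤ J k from fun hp => h hp
    induction k with
    | zero => exact fun p _ e he => absurd he (Nat.not_lt_zero _)
    | succ k ih =>
      rw [pow_succ']
      refine Ideal.mul_le.2 fun a ha b hb => ?_
      induction ha using Submodule.span_induction with
      | mem a ha =>
        obtain ⟨i, rfl⟩ := ha
        intro e he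
        rw [hv]
        split_ifs with h
        · exact ih hb _ (by have := hle h; omega)
        · rfl
      | zero => simp
      | add a a' _ _ h h' => rw [add_mul]; exact add_mem h h'
      | smul c a _ h => rw [smul_mul_assoc]; exact Submodule.smul_mem _ c h
  · induction k generalizing p with
    | zero => simp
    | succ k ih =>
      intro hp
      rcases isEmpty_or_nonempty ι with hι | hι
      · rw [show p = 0 from sx_ext fun e => by
          rw [hp e (not_not.1 fun he => (hd e (by omega)).elim fun i _ => hι.elim i), map_zero]]
        exact zero_mem _
      -- Assign to each exponent of nonzero degree one variable dividing it. Grouping the terms of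
      -- `p` by that variable writes `p` as `∑ v i * p_i`, where `p_i` vanishes in degrees below
      -- `k`.
      choose! ch hch using hd
      have key : p = ∑ i, v i * sxMk fun e => if ch (e + δ i) = i then sxCoeff (e + δ i) p else 0 := by
        refine sx_ext fun e => ?_
        rw [map_sum]
        simp only [hv, sxCoeff_sxMk]
        by_cases he : d e = 0
        · rw [hp e (by omega), Finset.sum_eq_zero fun i _ => ?_]
          rw [if_neg fun h => by have := hle h; omega]
        · rw [Finset.sum_eq_single (ch e)]
          · rw [if_pos (hch e he), tsub_add_cancel_of_le (hch e he), if_pos rfl]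
          · intro i _ hi
            split_ifs with h1 h2
            · rw [tsub_add_cancel_of_le h1] at h2
              exact absurd h2.symm hi
            · rfl
            · rfl
          · simp
      rw [key, pow_succ']
      refine Submodule.sum_mem _ fun i _ => Ideal.mul_mem_mul
        (Ideal.subset_span (Set.mem_range_self i)) (ih _ fun e he => ?_)
      rw [sxCoeff_sxMk]
      split_ifs with h
      · exact hp _ (by rw [map_add, hδ]; omega)
      · rfl

theorem exists_single_le_of_degree_ne_zero {k : ℕ} {a : Fin k →₀ ℕ} (h : a.degree ≠ 0) :
    ∃ i, Finsupp.single i 1 ≤ a := by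
  by_contra! hne
  refine h ((Finsupp.degree_eq_zero_iff a).2 (Finsupp.ext fun i => ?_))
  have := hne i
  rw [Finsupp.single_le_iff] at this
  simp only [Finsupp.coe_zero, Pi.zero_apply]
  omega

theorem mem_sIdeal_pow (k : ℕ) (p : SXRing 𝕜 m n) :
    p ∈ sIdeal 𝕜 m n ^ k ↔ ∀ e, e.1.degree < k → sxCoeff e p = 0 :=
  mem_span_range_pow_iff ((Finsupp.degree : (Fin m →₀ ℕ) →+ ℕ).comp (AddMonoidHom.fst _ _))
    sxCoeff_sVar_mul (by simp) (fun e he => by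
      obtain ⟨i, hi⟩ := exists_single_le_of_degree_ne_zero he
      exact ⟨i, hi, zero_le⟩) k p

theorem mem_sxIdeal_pow (k : ℕ) (p : SXRing 𝕜 m n) :
    p ∈ sxIdeal 𝕜 m n ^ k ↔ ∀ e, e.1.degree + e.2.degree < k → sxCoeff e p = 0 := by
  rw [sxIdeal, ← Set.Sum.elim_range]
  refine mem_span_range_pow_iff
    (δ := Sum.elim (fun i => (Finsupp.single i 1, 0)) fun i => (0, Finsupp.single i 1))
    ((Finsupp.degree : (Fin m →₀ ℕ) →+ ℕ).comp (AddMonoidHom.fst _ _) +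
      (Finsupp.degree : (Fin n →₀ ℕ) →+ ℕ).comp (AddMonoidHom.snd _ _)) ?_ ?_ ?_ k p
  · rintro (i | i) p e
    · exact sxCoeff_sVar_mul i p e
    · exact sxCoeff_xVar_mul i p e
  · rintro (i | i) <;> simp
  · intro e he
    by_cases h1 : e.1.degree = 0
    · obtain ⟨i, hi⟩ := exists_single_le_of_degree_ne_zero (a := e.2)
        (by simp [h1] at he ⊢; exact he)
      exact ⟨Sum.inr i, zero_le, hi⟩
    · obtain ⟨i, hi⟩ := exists_single_le_of_degree_ne_zero h1
      exact ⟨Sum.inl i, hi, zero_le⟩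

theorem eq_zero_of_forall_mem_sxIdeal_pow {p : SXRing 𝕜 m n}
    (h : ∀ d, p ∈ sxIdeal 𝕜 m n ^ d) : p = 0 := by
  refine sx_ext fun e => ?_
  rw [map_zero]
  exact (mem_sxIdeal_pow _ p).1 (h _) e (Nat.lt_succ_self _)

/-- Completeness: each coefficient of the partial sums is eventually constant, which defines the
limit. -/
theorem exists_adicHasSum {u : ℕ → SXRing 𝕜 m n}
    (hu : ∀ d, ∃ M, ∀ i ≥ M, u i ∈ sxIdeal 𝕜 m n ^ d) : ∃ v, AdicHasSum u v := by
  choose M hM using hu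
  have hsum : ∀ e k k', M (e.1.degree + e.2.degree + 1) ≤ k → k ≤ k' →
      sxCoeff e (∑ i ∈ Finset.range k', u i) = sxCoeff e (∑ i ∈ Finset.range k, u i) := by
    intro e k k' hk hkk'
    rw [← Finset.sum_range_add_sum_Ico _ hkk', map_add, map_sum _ _ (Finset.Ico k k'),
      Finset.sum_eq_zero (s := Finset.Ico k k'), add_zero]
    intro i hi
    exact (mem_sxIdeal_pow _ _).1 (hM _ i (hk.trans (Finset.mem_Ico.1 hi).1)) e (Nat.lt_succ_self _)
  refine ⟨sxMk fun e => sxCoeff e (∑ i ∈ Finset.range (M (e.1.degree + e.2.degree + 1)), u i),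
    fun d => ⟨(Finset.range (d + 1)).sup M, fun k hk => (mem_sxIdeal_pow _ _).2 fun e he => ?_⟩⟩
  rw [map_sub, sxCoeff_sxMk, sub_eq_zero]
  refine (hsum e _ _ le_rfl (le_trans ?_ hk)).symm
  exact Finset.le_sup (f := M) (Finset.mem_range.2 (by omega))

end Coefficients

/-! ### Greatest elements and local degree orderings. -/

theorem greatest_spec {α : Type*} [Zero α] {lt : α → α → Prop}
    (tri : ∀ a b, lt a b ∨ a = b ∨ lt b a) (wf : WellFounded fun a b => lt b a) {S : Set α}
    (hS : S.Nonempty) : greatest lt S ∈ S ∧ ∀ e ∈ S, e ≠ greatest lt S → lt e (greatest lt S) := by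
  have h : ∃ e ∈ S, ∀ e' ∈ S, e' ≠ e → lt e' e := by
    obtain ⟨e, he, hmax⟩ := wf.has_min S hS
    refine ⟨e, he, fun e' he' hne => ?_⟩
    rcases tri e' e with h | h | h
    · exact h
    · exact absurd h hne
    · exact absurd h (hmax e' he')
  rw [greatest, dif_pos h]
  exact h.choose_spec

namespace LocalDegreeOrder

variable {k : ℕ} (o : LocalDegreeOrder k)

theorem lt_irrefl (a : Fin k →₀ ℕ) : ¬ o.lt a a := o.strictTotal.toIrrefl.irrefl a

theorem lt_trans {a b c : Fin k →₀ ℕ} (h : o.lt a b) (h' : o.lt b c) : o.lt a c :=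
  o.strictTotal.toIsTrans.trans a b c h h'

theorem lt_asymm {a b : Fin k →₀ ℕ} (h : o.lt a b) : ¬ o.lt b a :=
  fun h' => o.lt_irrefl a (o.lt_trans h h')

theorem lt_trichotomy (a b : Fin k →₀ ℕ) : o.lt a b ∨ a = b ∨ o.lt b a :=
  have := o.strictTotal
  trichotomous_of o.lt a b

theorem deg_add (a b : Fin k →₀ ℕ) : o.deg (a + b) = o.deg a + o.deg b := by
  simp [deg, add_mul, Finset.sum_add_distrib]

theorem deg_nonpos (a : Fin k →₀ ℕ) : o.deg a ≤ 0 :=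
  Finset.sum_nonpos fun i _ => mul_nonpos_of_nonneg_of_nonpos (Nat.cast_nonneg _) (o.wt_neg i).le

theorem deg_le_of_le {a b : Fin k →₀ ℕ} (h : a ≤ b) : o.deg b ≤ o.deg a := by
  rw [← add_tsub_cancel_of_le h, deg_add]
  linarith [o.deg_nonpos (b - a)]

theorem deg_le_of_not_lt {a b : Fin k →₀ ℕ} (h : ¬ o.lt a b) : o.deg b ≤ o.deg a :=
  not_lt.1 fun h' => h (o.lt_of_deg_lt a b h')

theorem lt_of_lt {a b : Fin k →₀ ℕ} (h : a < b) : o.lt b a := by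
  refine o.lt_of_deg_lt _ _ (Finset.sum_lt_sum (fun i _ => ?_) ?_)
  · exact mul_le_mul_of_nonpos_right (Nat.cast_le.2 (h.le i)) (o.wt_neg i).le
  · obtain ⟨i, hi⟩ : ∃ i, a i < b i := by
      by_contra! hne
      exact h.not_ge fun i => hne i
    exact ⟨i, Finset.mem_univ i, mul_lt_mul_of_neg_right (Nat.cast_lt.2 hi) (o.wt_neg i)⟩

theorem exists_neg_mul_degree_le_deg :
    ∃ w : ℚ, 0 < w ∧ ∀ a : Fin k →₀ ℕ, -(w * a.degree) ≤ o.deg a := by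
  refine ⟨1 + ∑ i, -o.wt i, ?_, fun a => ?_⟩
  · have : 0 ≤ ∑ i, -o.wt i := Finset.sum_nonneg fun i _ => by linarith [o.wt_neg i]
    linarith
  · rw [deg, Finsupp.degree_eq_sum, Nat.cast_sum, Finset.mul_sum, ← Finset.sum_neg_distrib]
    refine Finset.sum_le_sum fun i _ => ?_
    have h : -o.wt i ≤ ∑ i, -o.wt i :=
      Finset.single_le_sum (f := fun i => -o.wt i) (fun i _ => by linarith [o.wt_neg i])
        (Finset.mem_univ i)
    have h' : (0 : ℚ) ≤ a i := Nat.cast_nonneg _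
    nlinarith

theorem finite_le_deg (c : ℚ) : {a : Fin k →₀ ℕ | c ≤ o.deg a}.Finite := by
  refine (Set.finite_Iic (Finsupp.equivFunOnFinite.symm fun i => ⌈c / o.wt i⌉₊)).subset
    fun a ha i => ?_
  have h : o.deg a ≤ a i * o.wt i := by
    rw [deg, ← Finset.add_sum_erase _ _ (Finset.mem_univ i)]
    have : ∑ j ∈ Finset.univ.erase i, (a j : ℚ) * o.wt j ≤ 0 := Finset.sum_nonpos fun j _ =>
      mul_nonpos_of_nonneg_of_nonpos (Nat.cast_nonneg _) (o.wt_neg j).le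
    linarith
  have h' : (a i : ℚ) ≤ c / o.wt i := by
    rw [le_div_iff_of_neg (o.wt_neg i)]
    exact le_trans ha h
  exact_mod_cast h'.trans (Nat.le_ceil _)

/-- All weights being negative, only finitely many monomials exceed a given one, and their number is
a decreasing measure. Hence power series have leading terms. -/
theorem wellFounded_gt : WellFounded fun a b => o.lt b a := by
  have hfin : ∀ a, {b | o.lt a b}.Finite := fun a =>
    (o.finite_le_deg (o.deg a)).subset fun b hb => o.deg_le_of_not_lt (o.lt_asymm hb)
  refine Subrelation.wf (fun {b a} h => ?_) (measure fun a => {b | o.lt a b}.ncard).wf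
  exact Set.ncard_lt_ncard ⟨fun c hc => o.lt_trans h hc, fun hne => o.lt_irrefl b (hne h)⟩ (hfin a)

variable {𝕜 : Type*} [Field 𝕜]

theorem lexp_spec {p : MvPowerSeries (Fin k) 𝕜} (hp : p ≠ 0) :
    MvPowerSeries.coeff (o.lexp p) p ≠ 0 ∧
      ∀ a, MvPowerSeries.coeff a p ≠ 0 → a ≠ o.lexp p → o.lt a (o.lexp p) :=
  greatest_spec (S := {a | MvPowerSeries.coeff a p ≠ 0}) o.lt_trichotomy o.wellFounded_gt
    ((MvPowerSeries.ne_zero_iff_exists_coeff_ne_zero p).1 hp)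

end LocalDegreeOrder

/-! ### The block ordering and its leading terms. -/

section Block

variable {m n : ℕ} (os : LocalDegreeOrder m) (ox : LocalDegreeOrder n)

theorem blockLt_trichotomy (e e' : (Fin m →₀ ℕ) × (Fin n →₀ ℕ)) :
    blockLt os ox e e' ∨ e = e' ∨ blockLt os ox e' e := by
  rcases os.lt_trichotomy e.1 e'.1 with h | h | h
  · exact Or.inl (Or.inl h)
  · rcases ox.lt_trichotomy e.2 e'.2 with h' | h' | h'
    · exact Or.inl (Or.inr ⟨h, h'⟩)
    · exact Or.inr (Or.inl (Prod.ext h h'))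
    · exact Or.inr (Or.inr (Or.inr ⟨h.symm, h'⟩))
  · exact Or.inr (Or.inr (Or.inl h))

theorem blockLt_irrefl (e : (Fin m →₀ ℕ) × (Fin n →₀ ℕ)) : ¬ blockLt os ox e e := by
  rintro (h | ⟨-, h⟩)
  · exact os.lt_irrefl _ h
  · exact ox.lt_irrefl _ h

theorem blockLt_trans {e e' e'' : (Fin m →₀ ℕ) × (Fin n →₀ ℕ)} (h : blockLt os ox e e')
    (h' : blockLt os ox e' e'') : blockLt os ox e e'' := by
  rcases h with h | ⟨h1, h2⟩ <;> rcases h' with h' | ⟨h1', h2'⟩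
  · exact Or.inl (os.lt_trans h h')
  · exact Or.inl (h1' ▸ h)
  · exact Or.inl (h1 ▸ h')
  · exact Or.inr ⟨h1.trans h1', ox.lt_trans h2 h2'⟩

theorem wellFounded_blockLt : WellFounded fun e e' => blockLt os ox e' e := by
  refine Subrelation.wf (fun {e e'} h => ?_)
    (WellFounded.prod_lex os.wellFounded_gt ox.wellFounded_gt)
  rw [Prod.lex_def]
  exact h.imp_right fun h => ⟨h.1.symm, h.2⟩

theorem exists_blockLt_greatest {S : Set ((Fin m →₀ ℕ) × (Fin n →₀ ℕ))} (hS : S.Nonempty) :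
    ∃ e ∈ S, ∀ e' ∈ S, ¬ blockLt os ox e e' :=
  (wellFounded_blockLt os ox).has_min S hS

variable {𝕜 : Type*} [Field 𝕜] {p : SXRing 𝕜 m n}

theorem sxLexp_mem (hp : p ≠ 0) : sxLexp os ox p ∈ sxSupport p :=
  (greatest_spec (blockLt_trichotomy os ox) (wellFounded_blockLt os ox)
    (exists_sxCoeff_ne_zero hp)).1

theorem blockLt_sxLexp (hp : p ≠ 0) {e} (he : e ∈ sxSupport p) (hne : e ≠ sxLexp os ox p) :
    blockLt os ox e (sxLexp os ox p) :=
  (greatest_spec (blockLt_trichotomy os ox) (wellFounded_blockLt os ox)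
    (exists_sxCoeff_ne_zero hp)).2 e he hne

theorem not_sxLexp_blockLt {e} (he : e ∈ sxSupport p) : ¬ blockLt os ox (sxLexp os ox p) e := by
  have hp : p ≠ 0 := by rintro rfl; exact he (map_zero (sxCoeff e))
  by_cases h : e = sxLexp os ox p
  · rw [← h]; exact blockLt_irrefl os ox e
  · exact fun h' => blockLt_irrefl os ox _ (blockLt_trans os ox h' (blockLt_sxLexp os ox hp he h))

theorem sLexp_eq_sxLexp_fst (hp : p ≠ 0) : sLexp os p = (sxLexp os ox p).1 := by
  obtain ⟨⟨e, he, h1⟩, h2⟩ := greatest_spec os.lt_trichotomy os.wellFounded_gt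
    ((exists_sxCoeff_ne_zero hp).image Prod.fst)
  by_contra hne
  have h3 := h2 _ ⟨_, sxLexp_mem os ox hp, rfl⟩ (Ne.symm hne)
  rw [← h1] at h3
  exact not_sxLexp_blockLt os ox he (Or.inl h3)

open scoped Classical in
theorem sxCoeff_sLead (p : SXRing 𝕜 m n) (e) :
    sxCoeff e (sLead os p) = if e.1 = sLexp os p then sxCoeff e p else 0 := by
  change MvPowerSeries.coeff e.1 (MvPowerSeries.monomial _ _) = _
  rw [MvPowerSeries.coeff_monomial]
  split_ifs with h
  · rw [← h]; rfl
  · rfl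

open scoped Classical in
theorem sxCoeff_sxLead (p : SXRing 𝕜 m n) (e) :
    sxCoeff e (sxLead os ox p) = if e = sxLexp os ox p then sxCoeff e p else 0 := by
  rw [sxLead, sxCoeff_apply, MvPowerSeries.coeff_monomial]
  by_cases h2 : e.2 = (sxLexp os ox p).2
  · rw [if_pos h2, MvPowerSeries.coeff_monomial]
    by_cases h1 : e.1 = (sxLexp os ox p).1
    · rw [if_pos h1, if_pos (Prod.ext h1 h2), ← h1, ← h2]; rfl
    · rw [if_neg h1, if_neg fun h => h1 (congrArg Prod.fst h)]
  · rw [if_neg h2, if_neg fun h => h2 (congrArg Prod.snd h), map_zero]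

end Block

/-! ### Differential operators as perturbations of multiplication operators. -/

section Operators

variable {𝕜 : Type*} [Field 𝕜] {m n r l : ℕ}

theorem DiffOp.act_apply (P : DiffOp 𝕜 m n) (q : SXRing 𝕜 m n) :
    P.act q = P.sum fun γ c => c * partialPow 𝕜 m n γ q := by
  rw [DiffOp.act, Finsupp.sum, LinearMap.sum_apply]
  rfl

theorem DiffOp.act_sub (P Q : DiffOp 𝕜 m n) (q : SXRing 𝕜 m n) :
    (P - Q).act q = P.act q - Q.act q := by
  simp only [DiffOp.act_apply]
  exact Finsupp.sum_sub_index fun γ c c' => sub_mul _ _ _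

theorem DiffOp.act_smul (c : SXRing 𝕜 m n) (P : DiffOp 𝕜 m n) (q : SXRing 𝕜 m n) :
    DiffOp.act (c • P) q = c * P.act q := by
  simp only [DiffOp.act_apply]
  rw [Finsupp.sum_smul_index fun γ => zero_mul _, Finsupp.mul_sum]
  simp only [mul_assoc]

theorem DiffOp.act_sum {ι : Type*} (s : Finset ι) (P : ι → DiffOp 𝕜 m n) (q : SXRing 𝕜 m n) :
    DiffOp.act (∑ i ∈ s, P i) q = ∑ i ∈ s, (P i).act q := by
  simp only [DiffOp.act_apply]
  exact (Finsupp.sum_finsetSum_index (fun γ => zero_mul _) fun γ c c' => add_mul _ _ _).symm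

theorem DiffOp.act_ofSeries (p : MvPowerSeries (Fin n) 𝕜) (q : SXRing 𝕜 m n) :
    (DiffOp.ofSeries m p).act q = ofX 𝕜 m n p * q := by
  rw [DiffOp.act_apply, DiffOp.ofSeries, Finsupp.sum_single_index (zero_mul _)]
  simp [partialPow]

/-- Only this implication is available: in positive characteristic the integer factors produced by
differentiation may vanish. -/
theorem sxCoeff_pderiv_pow_ne_zero {i : Fin n} {k : ℕ} {q : SXRing 𝕜 m n} {e}
    (h : sxCoeff e ((((MvPowerSeries.pderiv (SRing 𝕜 m) i).toLinearMap :
      Module.End (SRing 𝕜 m) (SXRing 𝕜 m n)) ^ k) q) ≠ 0) :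
    sxCoeff (e.1, e.2 + Finsupp.single i k) q ≠ 0 := by
  induction k generalizing e with
  | zero => simpa using h
  | succ k ih =>
    rw [pow_succ', Module.End.mul_apply, sxCoeff_apply, Derivation.coeFn_coe,
      MvPowerSeries.coeff_pderiv] at h
    have h' : sxCoeff (e.1, e.2 + Finsupp.single i 1)
        ((((MvPowerSeries.pderiv (SRing 𝕜 m) i).toLinearMap :
          Module.End (SRing 𝕜 m) (SXRing 𝕜 m n)) ^ k) q) ≠ 0 := by
      intro h0
      apply h
      have hc : ((e.2 i : SRing 𝕜 m) + 1) = MvPowerSeries.C ((e.2 i : 𝕜) + 1) := by simp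
      rw [hc, MvPowerSeries.coeff_mul_C]
      rw [sxCoeff_apply] at h0
      rw [h0, zero_mul]
    have := ih h'
    rwa [add_assoc, ← Finsupp.single_add, add_comm 1 k] at this

theorem sxCoeff_partialPow_ne_zero {γ : Fin n →₀ ℕ} {q : SXRing 𝕜 m n} {e}
    (h : sxCoeff e (partialPow 𝕜 m n γ q) ≠ 0) : sxCoeff (e.1, e.2 + γ) q ≠ 0 := by
  have key : ∀ (L : List (Fin n)) (e : (Fin m →₀ ℕ) × (Fin n →₀ ℕ)),
      sxCoeff e ((L.map fun i => ((MvPowerSeries.pderiv (SRing 𝕜 m) i).toLinearMap :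
        Module.End (SRing 𝕜 m) (SXRing 𝕜 m n)) ^ (γ i)).prod q) ≠ 0 →
      sxCoeff (e.1, e.2 + (L.map fun i => Finsupp.single i (γ i)).sum) q ≠ 0 := by
    intro L
    induction L with
    | nil => intro e h; simpa using h
    | cons i L ih =>
      intro e h
      rw [List.map_cons, List.prod_cons, Module.End.mul_apply] at h
      have := ih _ (sxCoeff_pderiv_pow_ne_zero h)
      rwa [List.map_cons, List.sum_cons, ← add_assoc]
  have := key _ _ h
  rwa [← Fin.sum_univ_def, Finsupp.univ_sum_single] at this

theorem DiffOp.exists_of_sxCoeff_act_ne_zero {P : DiffOp 𝕜 m n} {q : SXRing 𝕜 m n} {e}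
    (h : sxCoeff e (P.act q) ≠ 0) :
    ∃ γ ∈ P.support, ∃ a b, sxCoeff (a, b) q ≠ 0 ∧ a ≤ e.1 ∧ b ≤ e.2 + γ := by
  rw [DiffOp.act_apply, Finsupp.sum, map_sum] at h
  obtain ⟨γ, hγ, h⟩ := Finset.exists_ne_zero_of_sum_ne_zero h
  obtain ⟨u, v, rfl, -, hv⟩ := exists_of_sxCoeff_mul_ne_zero h
  exact ⟨γ, hγ, _, _, sxCoeff_partialPow_ne_zero hv, le_add_self, add_le_add_left le_add_self _⟩

/-- The operator `G` is multiplication by `g ∈ 𝕜[[x]]` up to terms that raise the exponent of `s`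
and lower the exponent of `x` at most by an element of `Γ`. -/
def IsPerturbation (Γ : Finset (Fin n →₀ ℕ)) (g : MvPowerSeries (Fin n) 𝕜)
    (G : SXRing 𝕜 m n →ₗ[SRing 𝕜 m] SXRing 𝕜 m n) : Prop :=
  ∀ p e, sxCoeff e (G p - ofX 𝕜 m n g * p) ≠ 0 →
    ∃ γ ∈ Γ, ∃ a b, sxCoeff (a, b) p ≠ 0 ∧ a < e.1 ∧ b ≤ e.2 + γ

theorem act_family_apply {F : DiffOp 𝕜 m n} {f : MvPowerSeries (Fin n) 𝕜} {D : Fin m → DiffOp 𝕜 m n}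
    (hF : F = DiffOp.ofSeries m f - ∑ j, sVar 𝕜 m n j • D j) (q : SXRing 𝕜 m n) :
    F.act q = ofX 𝕜 m n f * q - ∑ j, sVar 𝕜 m n j * (D j).act q := by
  rw [hF, DiffOp.act_sub, DiffOp.act_ofSeries, DiffOp.act_sum]
  simp only [DiffOp.act_smul]

/-- The difference `G_k p - g_k p` is `-∑ s_j D_{ji} (U_{ik} p)`. The factor `s_j` makes the
increase in `s` strict, and only the exponents `γ` of the `∂^γ` in `D` can lower exponents of `x`;
`Γ` collects these. -/
theorem isPerturbation_partialBasis {F : Fin r → DiffOp 𝕜 m n} {f : Fin r → MvPowerSeries (Fin n) 𝕜}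
    {D : Fin m → Fin r → DiffOp 𝕜 m n}
    (hF : ∀ i, F i = DiffOp.ofSeries m (f i) - ∑ j, sVar 𝕜 m n j • D j i)
    {g : Fin l → MvPowerSeries (Fin n) 𝕜} {U : Matrix (Fin r) (Fin l) (MvPowerSeries (Fin n) 𝕜)}
    (hU : ∀ k, g k = ∑ i, f i * U i k) :
    ∃ Γ, ∀ k, IsPerturbation Γ (g k) (partialBasis F U k) := by
  classical
  refine ⟨Finset.univ.biUnion fun j => Finset.univ.biUnion fun i => (D j i).support,
    fun k p e he => ?_⟩
  have h : partialBasis F U k p - ofX 𝕜 m n (g k) * p =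
      -∑ i, ∑ j, sVar 𝕜 m n j * (D j i).act (ofX 𝕜 m n (U i k) * p) := by
    rw [partialBasis, LinearMap.sum_apply, hU, map_sum, Finset.sum_mul, ← Finset.sum_sub_distrib,
      ← Finset.sum_neg_distrib]
    refine Finset.sum_congr rfl fun i _ => ?_
    rw [LinearMap.comp_apply, LinearMap.mulLeft_apply, act_family_apply (hF i), map_mul]
    ring
  rw [h, map_neg, neg_ne_zero, map_sum] at he
  obtain ⟨i, -, he⟩ := Finset.exists_ne_zero_of_sum_ne_zero he
  rw [map_sum] at he
  obtain ⟨j, -, he⟩ := Finset.exists_ne_zero_of_sum_ne_zero he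
  rw [sxCoeff_sVar_mul] at he
  split_ifs at he with hj
  · obtain ⟨γ, hγ, a, b, hq, ha, hb⟩ := DiffOp.exists_of_sxCoeff_act_ne_zero he
    obtain ⟨u, b', rfl, -, hp⟩ := exists_of_sxCoeff_ofX_mul_ne_zero hq
    refine ⟨γ, by simpa using ⟨j, i, Finsupp.mem_support_iff.1 hγ⟩, a, b', hp, ?_,
      (le_add_self.trans hb).trans (by simp)⟩
    have hj1 : Finsupp.single j 1 ≤ e.1 := hj.1
    refine lt_of_le_of_lt ha (lt_of_le_of_ne tsub_le_self fun h => ?_)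
    have h1 := DFunLike.congr_fun h j
    have h2 := hj1 j
    simp at h1 h2
    omega
  · exact absurd rfl he

theorem partialBasis_mem_range (F : Fin r → DiffOp 𝕜 m n)
    (U : Matrix (Fin r) (Fin l) (MvPowerSeries (Fin n) 𝕜)) (k : Fin l) (p : SXRing 𝕜 m n) :
    partialBasis F U k p ∈ LinearMap.range (familyMap F) := by
  refine ⟨fun i => ofX 𝕜 m n (U i k) * p, ?_⟩
  simp [familyMap, partialBasis, LinearMap.sum_apply]

namespace IsPerturbation

variable {Γ : Finset (Fin n →₀ ℕ)} {g : MvPowerSeries (Fin n) 𝕜}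
  {G : SXRing 𝕜 m n →ₗ[SRing 𝕜 m] SXRing 𝕜 m n}

theorem exists_of_sxCoeff_ne_zero (hG : IsPerturbation Γ g G) {p : SXRing 𝕜 m n} {e}
    (h : sxCoeff e (G p) ≠ 0) :
    (∃ u b, u + b = e.2 ∧ MvPowerSeries.coeff u g ≠ 0 ∧ sxCoeff (e.1, b) p ≠ 0) ∨
    ∃ γ ∈ Γ, ∃ a b, sxCoeff (a, b) p ≠ 0 ∧ a < e.1 ∧ b ≤ e.2 + γ := by
  by_cases h' : sxCoeff e (ofX 𝕜 m n g * p) = 0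
  · refine Or.inr (hG p e ?_)
    rwa [map_sub, h', sub_zero]
  · exact Or.inl (exists_of_sxCoeff_ofX_mul_ne_zero h')

/-- The coefficient of `G p` at a monomial that is at least the leading term of `g p`. -/
theorem sxCoeff_apply_of_not_blockLt (hG : IsPerturbation Γ g G) (os : LocalDegreeOrder m)
    (ox : LocalDegreeOrder n) (hg : g ≠ 0) {p : SXRing 𝕜 m n} {e : (Fin m →₀ ℕ) × (Fin n →₀ ℕ)}
    (h : ∀ w ∈ sxSupport p, ¬ blockLt os ox e (w.1, ox.lexp g + w.2)) :
    sxCoeff e (G p) = if ox.lexp g ≤ e.2 then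
      MvPowerSeries.coeff (ox.lexp g) g * sxCoeff (e.1, e.2 - ox.lexp g) p else 0 := by
  have h1 : sxCoeff e (G p) = sxCoeff e (ofX 𝕜 m n g * p) := by
    rw [← sub_eq_zero, ← map_sub]
    by_contra hne
    obtain ⟨γ, -, a, b, hp, ha, -⟩ := hG p e hne
    exact h _ hp (Or.inl (os.lt_of_lt ha))
  have h2 : ∀ w : (Fin n →₀ ℕ) × (Fin n →₀ ℕ), w.1 + w.2 = e.2 →
      MvPowerSeries.coeff w.1 g * sxCoeff (e.1, w.2) p ≠ 0 → w.1 = ox.lexp g := by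
    intro w hw hne
    by_contra hne'
    refine h _ (mem_sxSupport.2 (right_ne_zero_of_mul hne)) (Or.inr ⟨rfl, ?_⟩)
    rw [← hw]
    exact ox.add_right _ _ _ ((ox.lexp_spec hg).2 _ (left_ne_zero_of_mul hne) hne')
  rw [h1, sxCoeff_ofX_mul]
  split_ifs with hle
  · rw [Finset.sum_eq_single (ox.lexp g, e.2 - ox.lexp g)]
    · intro w hw hne
      rw [Finset.HasAntidiagonal.mem_antidiagonal] at hw
      by_contra h0
      have h3 := h2 w hw h0
      refine hne (Prod.ext h3 ?_)
      rw [← hw, h3, add_tsub_cancel_left]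
    · intro hne
      rw [Finset.HasAntidiagonal.mem_antidiagonal] at hne
      exact absurd (add_tsub_cancel_of_le hle) hne
  · refine Finset.sum_eq_zero fun w hw => ?_
    rw [Finset.HasAntidiagonal.mem_antidiagonal] at hw
    by_contra h0
    rw [← hw, h2 w hw h0] at hle
    exact hle le_self_add

/-- Differentiation costs at most the largest `|γ|` in adic order, so `G` is continuous and commutes
with convergent sums. -/
theorem exists_map_mem_sxIdeal_pow (hG : IsPerturbation Γ g G) :
    ∃ c, ∀ d p, p ∈ sxIdeal 𝕜 m n ^ (d + c) → G p ∈ sxIdeal 𝕜 m n ^ d := by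
  refine ⟨Γ.sup Finsupp.degree, fun d p hp => (mem_sxIdeal_pow _ _).2 fun e he => ?_⟩
  rw [mem_sxIdeal_pow] at hp
  by_contra h
  rcases hG.exists_of_sxCoeff_ne_zero h with ⟨u, b, hub, -, hb⟩ | ⟨γ, hγ, a, b, hab, ha, hb⟩
  · refine hb (hp _ ?_)
    rw [← hub, map_add] at he
    simp only
    omega
  · refine hab (hp _ ?_)
    have h1 := Finsupp.degree_mono ha.le
    have h2 := Finsupp.degree_mono hb
    have h3 : γ.degree ≤ Γ.sup Finsupp.degree := Finset.le_sup (f := Finsupp.degree) hγ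
    rw [map_add] at h2
    simp only at h1 h2 ⊢
    omega

theorem adicHasSum_map (hG : IsPerturbation Γ g G) {u : ℕ → SXRing 𝕜 m n} {v : SXRing 𝕜 m n}
    (h : AdicHasSum u v) : AdicHasSum (fun i => G (u i)) (G v) := by
  obtain ⟨c, hc⟩ := hG.exists_map_mem_sxIdeal_pow
  intro d
  obtain ⟨M, hM⟩ := h (d + c)
  refine ⟨M, fun k hk => ?_⟩
  rw [← map_sum, ← map_sub]
  exact hc d _ (hM k hk)

end IsPerturbation

end Operators

theorem degree_lt_degree {k : ℕ} {a b : Fin k →₀ ℕ} (h : a < b) : a.degree < b.degree := by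
  rw [← add_tsub_cancel_of_le h.le, map_add, Nat.lt_add_right_iff_pos, Nat.pos_iff_ne_zero, ne_eq,
    Finsupp.degree_eq_zero_iff, tsub_eq_zero_iff_le]
  exact h.not_ge

/-! ### One reduction step and the slope bound. -/

section Reduction

variable {𝕜 : Type*} [Field 𝕜] {m n : ℕ} (os : LocalDegreeOrder m) (ox : LocalDegreeOrder n)

theorem ofX_lead (g : MvPowerSeries (Fin n) 𝕜) : ofX 𝕜 m n (ox.lead g) =
    MvPowerSeries.monomial (ox.lexp g) (MvPowerSeries.C (MvPowerSeries.coeff (ox.lexp g) g)) := by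
  rw [LocalDegreeOrder.lead, ofX, MvPowerSeries.map_monomial]

theorem sxCoeff_ofX_lead_mul (g : MvPowerSeries (Fin n) 𝕜) (t : SXRing 𝕜 m n) (e) :
    sxCoeff e (ofX 𝕜 m n (ox.lead g) * t) = if ox.lexp g ≤ e.2 then
      MvPowerSeries.coeff (ox.lexp g) g * sxCoeff (e.1, e.2 - ox.lexp g) t else 0 := by
  classical
  rw [ofX_lead, sxCoeff_apply, MvPowerSeries.coeff_monomial_mul]
  split_ifs with h
  · rw [MvPowerSeries.coeff_C_mul, sxCoeff_apply]
  · rw [map_zero]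

theorem ofX_lead_dvd_sxLead {g : MvPowerSeries (Fin n) 𝕜} (hg : g ≠ 0) {ρ : SXRing 𝕜 m n}
    (h : ox.lexp g ≤ (sxLexp os ox ρ).2) : ofX 𝕜 m n (ox.lead g) ∣ sxLead os ox ρ := by
  refine ⟨MvPowerSeries.monomial ((sxLexp os ox ρ).2 - ox.lexp g)
    (MvPowerSeries.monomial (sxLexp os ox ρ).1 ((MvPowerSeries.coeff (ox.lexp g) g)⁻¹ *
      sxCoeff (sxLexp os ox ρ) ρ)), ?_⟩
  rw [ofX_lead, MvPowerSeries.monomial_mul_monomial, add_tsub_cancel_of_le h,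
    ← MvPowerSeries.monomial_zero_eq_C_apply, MvPowerSeries.monomial_mul_monomial, zero_add,
    mul_inv_cancel_left₀ (ox.lexp_spec hg).1]
  rfl

theorem eq_sxLexp_of_sxLead_eq {g : MvPowerSeries (Fin n) 𝕜} (hg : g ≠ 0) {ρ t : SXRing 𝕜 m n}
    (ht : sxLead os ox ρ = ofX 𝕜 m n (ox.lead g) * t) {w} (hw : w ∈ sxSupport t) :
    (w.1, ox.lexp g + w.2) = sxLexp os ox ρ := by
  classical
  have h := sxCoeff_ofX_lead_mul ox g t (w.1, ox.lexp g + w.2)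
  rw [← ht, if_pos le_self_add, add_tsub_cancel_left, sxCoeff_sxLead] at h
  by_contra hne
  rw [if_neg hne] at h
  exact mul_ne_zero (ox.lexp_spec hg).1 hw h.symm

theorem blockLt_of_mem_sxSupport_sub_sxLead {ρ : SXRing 𝕜 m n} (hρ : ρ ≠ 0) {e}
    (he : e ∈ sxSupport (ρ - sxLead os ox ρ)) : blockLt os ox e (sxLexp os ox ρ) := by
  classical
  rw [mem_sxSupport, map_sub, sxCoeff_sxLead] at he
  split_ifs at he with h
  · exact absurd (sub_self _) he
  · exact blockLt_sxLexp os ox hρ (by simpa [mem_sxSupport] using he) h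

/-- At monomials not below `lead(ρ)`, the series `G t` has the same coefficients as `lead(g) t =
lead(ρ)`, so the leading term cancels and nothing new appears above it. -/
theorem IsPerturbation.blockLt_of_mem_sxSupport_sub {Γ : Finset (Fin n →₀ ℕ)}
    {g : MvPowerSeries (Fin n) 𝕜} {G : SXRing 𝕜 m n →ₗ[SRing 𝕜 m] SXRing 𝕜 m n}
    (hG : IsPerturbation Γ g G) (hg : g ≠ 0) {ρ t : SXRing 𝕜 m n} (hρ : ρ ≠ 0)
    (ht : sxLead os ox ρ = ofX 𝕜 m n (ox.lead g) * t) {e} (he : e ∈ sxSupport (ρ - G t)) :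
    blockLt os ox e (sxLexp os ox ρ) := by
  by_contra hne
  refine hne (blockLt_of_mem_sxSupport_sub_sxLead os ox hρ ?_)
  rw [mem_sxSupport, map_sub, ht, sxCoeff_ofX_lead_mul]
  rw [mem_sxSupport, map_sub, hG.sxCoeff_apply_of_not_blockLt os ox hg] at he
  · exact he
  · intro w hw
    rwa [eq_sxLexp_of_sxLead_eq os ox hg ht hw]

/-- All terms `s^a x^b` of `p` satisfy `deg(x^b) ≤ δ + C |a|`. -/
def SlopeBound (C δ : ℚ) (p : SXRing 𝕜 m n) : Prop :=
  ∀ e ∈ sxSupport p, ox.deg e.2 ≤ δ + C * e.1.degree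

variable {ox} in
theorem SlopeBound.add {C δ : ℚ} {p q : SXRing 𝕜 m n} (hp : SlopeBound ox C δ p)
    (hq : SlopeBound ox C δ q) : SlopeBound ox C δ (p + q) := fun e he =>
  (mem_or_mem_of_mem_sxSupport_add he).elim (hp e) (hq e)

variable {ox} in
theorem SlopeBound.sub {C δ : ℚ} {p q : SXRing 𝕜 m n} (hp : SlopeBound ox C δ p)
    (hq : SlopeBound ox C δ q) : SlopeBound ox C δ (p - q) := by
  rw [sub_eq_add_neg]
  refine hp.add fun e he => hq e ?_
  rwa [mem_sxSupport, map_neg, neg_ne_zero] at he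

theorem slopeBound_zero (C δ : ℚ) : SlopeBound ox C δ (0 : SXRing 𝕜 m n) :=
  fun e he => absurd he (notMem_sxSupport_zero e)

variable {ox} in
theorem SlopeBound.sxLead {C δ : ℚ} {p : SXRing 𝕜 m n} (hp : SlopeBound ox C δ p) :
    SlopeBound ox C δ (sxLead os ox p) := by
  classical
  intro e he
  rw [mem_sxSupport, sxCoeff_sxLead] at he
  split_ifs at he with h
  · exact hp e he
  · exact absurd rfl he

variable {os ox} in
theorem SlopeBound.of_sxLead_eq {C δ : ℚ} {ρ : SXRing 𝕜 m n} (hp : SlopeBound ox C δ ρ)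
    (hρ : ρ ≠ 0) {g : MvPowerSeries (Fin n) 𝕜} (hg : g ≠ 0) {t : SXRing 𝕜 m n}
    (ht : _root_.sxLead os ox ρ = ofX 𝕜 m n (ox.lead g) * t) :
    SlopeBound ox C (δ - ox.deg (ox.lexp g)) t := by
  intro w hw
  have h := hp _ (sxLexp_mem os ox hρ)
  rw [← eq_sxLexp_of_sxLead_eq os ox hg ht hw, ox.deg_add] at h
  simp only at h
  linarith

variable {ox} in
-- Dividing by `lead(g)` raises the degree in `x` by `-deg(lead(g))`. Multiplying by `g` undoes
-- this; on the perturbation terms, `∂^γ` adds at most `-deg(x^γ)` more. There the exponent of `s`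
-- grows by at least one, which buys `C`.
theorem IsPerturbation.slopeBound {Γ : Finset (Fin n →₀ ℕ)}
    {g : MvPowerSeries (Fin n) 𝕜} {G : SXRing 𝕜 m n →ₗ[SRing 𝕜 m] SXRing 𝕜 m n}
    (hG : IsPerturbation Γ g G) (hg : g ≠ 0) {C δ : ℚ} (hC : 0 ≤ C)
    (hΓ : ∀ γ ∈ Γ, -ox.deg γ - ox.deg (ox.lexp g) ≤ C) {p : SXRing 𝕜 m n}
    (hp : SlopeBound ox C (δ - ox.deg (ox.lexp g)) p) : SlopeBound ox C δ (G p) := by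
  intro e he
  rcases hG.exists_of_sxCoeff_ne_zero he with ⟨u, b, hub, hu, hb⟩ | ⟨γ, hγ, a, b, hab, ha, hb⟩
  · have h1 := hp _ hb
    have h2 : ox.deg u ≤ ox.deg (ox.lexp g) := by
      by_cases h : u = ox.lexp g
      · rw [h]
      · exact ox.deg_le_of_not_lt (ox.lt_asymm ((ox.lexp_spec hg).2 u hu h))
    rw [← hub, ox.deg_add]
    simp only at h1
    linarith
  · have h1 := hp _ hab
    have h2 := ox.deg_le_of_le hb
    have h3 := hΓ γ hγ
    have h4 : (a.degree : ℚ) + 1 ≤ e.1.degree := by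
      exact_mod_cast degree_lt_degree ha
    rw [ox.deg_add] at h2
    simp only at h1
    nlinarith

theorem exists_slopeBound_imp_mem_sxIdeal_pow {C : ℚ} (hC : 0 ≤ C) (d : ℕ) :
    ∃ x : ℚ, ∀ δ ≤ x, ∀ p : SXRing 𝕜 m n, SlopeBound ox C δ p → p ∈ sxIdeal 𝕜 m n ^ d := by
  obtain ⟨w, hw, hdeg⟩ := ox.exists_neg_mul_degree_le_deg
  -- A term of total order below `d` has degree in `x` greater than `-w d`, whereas the slope bound
  -- allows at most `δ + C d`.
  refine ⟨-(C * d) - w * d, fun δ hδ p hp => (mem_sxIdeal_pow _ _).2 fun e he => ?_⟩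
  by_contra h
  have h1 := hp e h
  have h2 := hdeg e.2
  have h3 : (e.1.degree : ℚ) ≤ d := by exact_mod_cast (by omega : e.1.degree ≤ d)
  have h4 : (e.2.degree : ℚ) < d := by exact_mod_cast (by omega : e.2.degree < d)
  nlinarith

end Reduction

/-! ### The part split off by one step. -/

section Cutoff

variable {𝕜 : Type*} [Field 𝕜] {m n : ℕ} (os : LocalDegreeOrder m) (ox : LocalDegreeOrder n)
  (N : ℤ → ℚ) (p : SXRing 𝕜 m n) (K : ℤ)

theorem sxCoeff_cutoff (e) :
    sxCoeff e (cutoff os ox N p K) = sxCoeff e p ∨ sxCoeff e (cutoff os ox N p K) = 0 := by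
  classical
  rw [cutoff]
  split_ifs
  · exact Or.inl rfl
  · rw [sxCoeff_sLead]
    split_ifs
    · exact Or.inl rfl
    · exact Or.inr rfl
  · exact Or.inr (map_zero _)

theorem sxSupport_cutoff_subset : sxSupport (cutoff os ox N p K) ⊆ sxSupport p := by
  intro e he
  rcases sxCoeff_cutoff os ox N p K e with h | h
  · rwa [mem_sxSupport, h] at he
  · exact absurd h he

theorem sxSupport_sub_cutoff_subset : sxSupport (p - cutoff os ox N p K) ⊆ sxSupport p := by
  intro e he
  rw [mem_sxSupport, map_sub] at he
  rcases sxCoeff_cutoff os ox N p K e with h | h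
  · rw [h] at he
    exact absurd (sub_self _) he
  · rwa [h, sub_zero] at he

/-- All terms of `sLead os p` share the `s`-exponent of `lead(p)`, whose `x`-part is greatest among
them; so a degree bound on `lead(p)` holds for all of them. -/
theorem le_degree_or_deg_lt_of_mem_sxSupport_cutoff {e} (he : e ∈ sxSupport (cutoff os ox N p K)) :
    (-K).toNat ≤ e.1.degree ∨ os.deg e.1 + ox.deg e.2 < N K := by
  classical
  have hmem : ∀ {q : SXRing 𝕜 m n}, q ∈ sIdeal 𝕜 m n ^ (-K).toNat → e ∈ sxSupport q →
      (-K).toNat ≤ e.1.degree := fun hq he =>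
    not_lt.1 fun hlt => he ((mem_sIdeal_pow _ _).1 hq e hlt)
  have hp : e ∈ sxSupport p := sxSupport_cutoff_subset os ox N p K he
  rw [cutoff] at he
  split_ifs at he with h1 h2
  · exact Or.inl (hmem h1 he)
  · rcases h2 with h2 | h2
    · refine Or.inr (lt_of_le_of_lt ?_ h2)
      have hp0 : p ≠ 0 := by rintro rfl; exact notMem_sxSupport_zero e hp
      rw [mem_sxSupport, sxCoeff_sLead] at he
      have h3 : e.1 = (sxLexp os ox p).1 := by
        rw [← sLexp_eq_sxLexp_fst os ox hp0]
        by_contra hne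
        exact he (if_neg hne)
      have h4 := ox.deg_le_of_not_lt fun h => not_sxLexp_blockLt os ox hp (Or.inr ⟨h3.symm, h⟩)
      rw [h3]
      linarith
    · exact Or.inl (hmem h2 he)
  · exact absurd he (notMem_sxSupport_zero e)

end Cutoff

/-! ### Single calls of the algorithm: invariants and termination. -/

section Runs

variable {𝕜 : Type*} [Field 𝕜] {m n r l : ℕ} {os : LocalDegreeOrder m} {ox : LocalDegreeOrder n}
  {F : Fin r → DiffOp 𝕜 m n} {g : Fin l → MvPowerSeries (Fin n) 𝕜}
  {U : Matrix (Fin r) (Fin l) (MvPowerSeries (Fin n) 𝕜)} {Γ : Finset (Fin n →₀ ℕ)}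

/-- The pairs `(a, R)` for which `∑ g_k a_k + R` is a division with remainder by `g`: the terms of
`lead(g_k) a_k` are not divisible by `lead(g_{k'})` for any `k' < k`, and the terms of `R` are not
divisible by any leading term. -/
def divisionPairs (m : ℕ) (ox : LocalDegreeOrder n) (g : Fin l → MvPowerSeries (Fin n) 𝕜) :
    Submodule (SRing 𝕜 m) ((Fin l → SXRing 𝕜 m n) × SXRing 𝕜 m n) where
  carrier := {x | (∀ k, ∀ e ∈ sxSupport (x.1 k), ∀ k' < k, ¬ ox.lexp (g k') ≤ ox.lexp (g k) + e.2) ∧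
    ∀ e ∈ sxSupport x.2, ∀ k, ¬ ox.lexp (g k) ≤ e.2}
  add_mem' := fun hx hy =>
    ⟨fun k e he => (mem_or_mem_of_mem_sxSupport_add he).elim (hx.1 k e) (hy.1 k e),
      fun e he => (mem_or_mem_of_mem_sxSupport_add he).elim (hx.2 e) (hy.2 e)⟩
  zero_mem' := ⟨fun _ e he => absurd he (notMem_sxSupport_zero e),
    fun e he => absurd he (notMem_sxSupport_zero e)⟩
  smul_mem' := fun _ _ hx =>
    ⟨fun k e he => (exists_of_mem_sxSupport_smul he).elim fun a ha => hx.1 k (a, e.2) ha,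
      fun e he => (exists_of_mem_sxSupport_smul he).elim fun a ha => hx.2 (a, e.2) ha⟩

namespace NFRun

variable {N : ℤ → ℚ} {K : ℤ} {p R q : SXRing 𝕜 m n} {a : Fin l → SXRing 𝕜 m n}

theorem eq_add_add (h : NFRun os ox F g U N K p R a q) :
    p = R + ∑ k, partialBasis F U k (a k) + q := by
  induction h with
  | done p h => simpa [sub_eq_zero] using h
  | reduce p ρ hρ h k t ht hk R a q hrec ih =>
    have hsum : ∑ k', partialBasis F U k' ((a + Pi.single k t : Fin l → SXRing 𝕜 m n) k') =
        ∑ k', partialBasis F U k' (a k') + partialBasis F U k t := by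
      simp only [Pi.add_apply, map_add, Finset.sum_add_distrib]
      congr 1
      rw [Finset.sum_eq_single k (fun k' _ hne => by rw [Pi.single_eq_of_ne hne, map_zero])
        (by simp), Pi.single_eq_same]
    rw [hsum]
    linear_combination (exp := 1) ih - hρ
  | keep p ρ hρ h hk R a q hrec ih =>
    linear_combination (exp := 1) ih - hρ

theorem mem_divisionPairs (hg : ∀ k, g k ≠ 0) (h : NFRun os ox F g U N K p R a q) :
    (a, R) ∈ divisionPairs m ox g := by
  classical
  induction h with
  | done p h => exact zero_mem _
  | reduce p ρ hρ h k t ht hk R a q hrec ih =>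
    have hmem : (Pi.single k t, 0) ∈ divisionPairs m ox g := by
      refine ⟨fun k' e he k'' hk'' hle => ?_, fun e he => absurd he (notMem_sxSupport_zero e)⟩
      by_cases hkk : k' = k
      · subst hkk
        simp only [Pi.single_eq_same] at he
        refine hk k'' hk'' (ofX_lead_dvd_sxLead os ox (hg _) ?_)
        rwa [← eq_sxLexp_of_sxLead_eq os ox (hg _) ht he]
      · simp only [Pi.single_eq_of_ne hkk] at he
        exact notMem_sxSupport_zero e he
    simpa using add_mem ih hmem
  | keep p ρ hρ h hk R a q hrec ih =>
    have hmem : (0, sxLead os ox ρ) ∈ divisionPairs m ox g := by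
      refine ⟨fun k e he => absurd he (notMem_sxSupport_zero e), fun e he k hle => ?_⟩
      rw [mem_sxSupport, sxCoeff_sxLead] at he
      split_ifs at he with h'
      · exact hk k (ofX_lead_dvd_sxLead os ox (hg _) (h' ▸ hle))
      · exact he rfl
    simpa using add_mem hmem ih

theorem le_degree_or_deg_lt (h : NFRun os ox F g U N K p R a q) :
    ∀ e ∈ sxSupport q, (-K).toNat ≤ e.1.degree ∨ os.deg e.1 + ox.deg e.2 < N K := by
  induction h with
  | done p h => exact fun e he => le_degree_or_deg_lt_of_mem_sxSupport_cutoff os ox N p K he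
  | reduce p ρ hρ h k t ht hk R a q hrec ih =>
    exact fun e he => (mem_or_mem_of_mem_sxSupport_add he).elim
      (fun h => le_degree_or_deg_lt_of_mem_sxSupport_cutoff os ox N p K h) (ih e)
  | keep p ρ hρ h hk R a q hrec ih =>
    exact fun e he => (mem_or_mem_of_mem_sxSupport_add he).elim
      (fun h => le_degree_or_deg_lt_of_mem_sxSupport_cutoff os ox N p K h) (ih e)

theorem slopeBound (hg : ∀ k, g k ≠ 0) (hG : ∀ k, IsPerturbation Γ (g k) (partialBasis F U k))
    {C δ : ℚ} (hC : 0 ≤ C) (hΓ : ∀ γ ∈ Γ, ∀ k, -ox.deg γ - ox.deg (ox.lexp (g k)) ≤ C)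
    (hCg : ∀ k, -ox.deg (ox.lexp (g k)) ≤ C) (h : NFRun os ox F g U N K p R a q)
    (hp : SlopeBound ox C δ p) :
    SlopeBound ox C δ R ∧ (∀ k, SlopeBound ox C (δ + C) (a k)) ∧ SlopeBound ox C δ q := by
  classical
  have hcut : ∀ {p : SXRing 𝕜 m n}, SlopeBound ox C δ p →
      SlopeBound ox C δ (cutoff os ox N p K) ∧ SlopeBound ox C δ (p - cutoff os ox N p K) :=
    fun {p} hp => ⟨fun e he => hp e (sxSupport_cutoff_subset os ox N p K he),
      fun e he => hp e (sxSupport_sub_cutoff_subset os ox N p K he)⟩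
  induction h with
  | done p h => exact ⟨slopeBound_zero ox C δ, fun k => slopeBound_zero ox C _, (hcut hp).1⟩
  | reduce p ρ hρ h k t ht hk R a q hrec ih =>
    have hρb : SlopeBound ox C δ ρ := hρ ▸ (hcut hp).2
    have htb := hρb.of_sxLead_eq h (hg k) ht
    obtain ⟨h1, h2, h3⟩ := ih (hρb.sub ((hG k).slopeBound (hg k) hC (fun γ hγ => hΓ γ hγ k) htb))
    refine ⟨h1, fun k' => (h2 k').add ?_, (hcut hp).1.add h3⟩
    by_cases hkk : k' = k
    · subst hkk
      rw [Pi.single_eq_same]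
      intro e he
      have := htb e he
      have := hCg k'
      linarith
    · rw [Pi.single_eq_of_ne hkk]
      exact slopeBound_zero ox C _
  | keep p ρ hρ h hk R a q hrec ih =>
    have hρb : SlopeBound ox C δ ρ := hρ ▸ (hcut hp).2
    obtain ⟨h1, h2, h3⟩ := ih (hρb.sub (hρb.sxLead os))
    exact ⟨(hρb.sxLead os).add h1, h2, (hcut hp).1.add h3⟩

variable (os ox) in
/-- Every call of the normal form algorithm terminates. -/
theorem exists_run (hg : ∀ k, g k ≠ 0) (hG : ∀ k, IsPerturbation Γ (g k) (partialBasis F U k))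
    (N : ℤ → ℚ) (K : ℤ) (p : SXRing 𝕜 m n) : ∃ R a q, NFRun os ox F g U N K p R a q := by
  classical
  obtain ⟨w, hw, hdeg⟩ := os.exists_neg_mul_degree_le_deg
  -- The termination measure counts the `s`-exponents in `A` not above the leading one of `p`, plus
  -- the monomials in `T` not above its leading monomial. As long as `p ∉ ⟨s⟩^{-K}`, some term has
  -- `s`-order below `-K`, which forces the leading `s`-exponent into `A`.
  let A := (os.finite_le_deg (-(w * (-K).toNat))).toFinset
  let T := A ×ˢ (ox.finite_le_deg (N K)).toFinset
  let S₁ : SXRing 𝕜 m n → Finset (Fin m →₀ ℕ) := fun p =>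
    A.filter fun α => ∃ e ∈ sxSupport p, ¬ os.lt e.1 α
  let S₂ : SXRing 𝕜 m n → Finset ((Fin m →₀ ℕ) × (Fin n →₀ ℕ)) := fun p =>
    T.filter fun v => ∃ e ∈ sxSupport p, ¬ blockLt os ox e v
  induction hν : (S₁ p).card + (S₂ p).card using Nat.strong_induction_on generalizing p with
  | _ ν ih =>
  by_cases hρ : p - cutoff os ox N p K = 0
  · exact ⟨_, _, _, NFRun.done p hρ⟩
  set ρ := p - cutoff os ox N p K with hρdef
  have hsub : sxSupport ρ ⊆ sxSupport p := sxSupport_sub_cutoff_subset os ox N p K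
  have hlρ := sxLexp_mem os ox hρ
  have hp0 : p ≠ 0 := by
    rintro rfl
    exact notMem_sxSupport_zero _ (hsub hlρ)
  have hpI : p ∉ sIdeal 𝕜 m n ^ (-K).toNat := fun h => hρ (by
    rw [hρdef, cutoff, if_pos h, sub_self])
  have hlp := sxLexp_mem os ox hp0
  have hlpA : (sxLexp os ox p).1 ∈ A := by
    rw [mem_sIdeal_pow] at hpI
    push Not at hpI
    obtain ⟨e, he1, he2⟩ := hpI
    rw [Set.Finite.mem_toFinset]
    have h1 := os.deg_le_of_not_lt fun h => not_sxLexp_blockLt os ox (mem_sxSupport.2 he2) (Or.inl h)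
    have h2 := hdeg e.1
    have h3 : (e.1.degree : ℚ) ≤ (-K).toNat := by exact_mod_cast he1.le
    simp only [Set.mem_ofPred_eq]
    nlinarith
  have key : ∀ p', (∀ e ∈ sxSupport p', blockLt os ox e (sxLexp os ox ρ)) →
      (S₁ p').card + (S₂ p').card < ν := by
    intro p' hp'
    have hS₁ : S₁ p' ⊆ S₁ p := by
      refine Finset.monotone_filter_right _ fun α _ ⟨e, he, hlt⟩ => ⟨_, hsub hlρ, fun h => hlt ?_⟩
      rcases hp' e he with h' | h'
      · exact os.lt_trans h' h
      · exact h'.1 ▸ h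
    have hS₂ : S₂ p' ⊆ S₂ p := Finset.monotone_filter_right _ fun v _ ⟨e, he, hlt⟩ =>
      ⟨_, hsub hlρ, fun h => hlt (blockLt_trans os ox (hp' e he) h)⟩
    rw [← hν]
    -- If the `s`-leading part is split off, the leading `s`-exponent drops and the first count
    -- decreases. Otherwise `ρ = p`, and the degree in `x` of `lead(p)` is at least `N K`, as
    -- degrees in `s` are nonpositive; so `lead(p)` lies in `T` and the second count decreases.
    by_cases hcut : os.deg (sxLexp os ox p).1 + ox.deg (sxLexp os ox p).2 < N K ∨
      sLead os p ∈ sIdeal 𝕜 m n ^ (-K).toNat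
    · refine add_lt_add_of_lt_of_le (Finset.card_lt_card ⟨hS₁, fun hle => ?_⟩)
        (Finset.card_le_card hS₂)
      have hmem : (sxLexp os ox p).1 ∈ S₁ p :=
        Finset.mem_filter.2 ⟨hlpA, _, hlp, os.lt_irrefl _⟩
      obtain ⟨-, e, he, hlt⟩ := Finset.mem_filter.1 (hle hmem)
      have hne : (sxLexp os ox ρ).1 ≠ (sxLexp os ox p).1 := by
        intro heq
        refine hlρ ?_
        change sxCoeff (sxLexp os ox ρ) ρ = 0
        rw [hρdef, cutoff, if_neg hpI, if_pos hcut, map_sub, sxCoeff_sLead,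
          sLexp_eq_sxLexp_fst os ox hp0]
        rw [if_pos (by rw [← heq, hρdef, cutoff, if_neg hpI, if_pos hcut]), sub_self]
      have hlt' : os.lt (sxLexp os ox ρ).1 (sxLexp os ox p).1 := by
        rcases os.lt_trichotomy (sxLexp os ox ρ).1 (sxLexp os ox p).1 with h | h | h
        · exact h
        · exact absurd h hne
        · exact absurd (Or.inl h) (not_sxLexp_blockLt os ox (hsub hlρ))
      rcases hp' e he with h | h
      · exact hlt (os.lt_trans h hlt')
      · exact hlt (h.1 ▸ hlt')
    · have hρp : ρ = p := by rw [hρdef, cutoff, if_neg hpI, if_neg hcut, sub_zero]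
      refine add_lt_add_of_le_of_lt (Finset.card_le_card hS₁)
        (Finset.card_lt_card ⟨hS₂, fun hle => ?_⟩)
      have hmem : sxLexp os ox p ∈ S₂ p := by
        refine Finset.mem_filter.2 ⟨Finset.mem_product.2 ⟨hlpA, ?_⟩, _, hlp, blockLt_irrefl os ox _⟩
        rw [Set.Finite.mem_toFinset, Set.mem_ofPred_eq]
        push Not at hcut
        linarith [hcut.1, os.deg_nonpos (sxLexp os ox p).1]
      obtain ⟨-, e, he, hlt⟩ := Finset.mem_filter.1 (hle hmem)
      have := hp' e he
      rw [hρp] at this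
      exact hlt this
  by_cases hred : ∃ k, ofX 𝕜 m n (ox.lead (g k)) ∣ sxLead os ox ρ
  · obtain ⟨k, ⟨t, ht⟩, hk⟩ := WellFounded.has_min (wellFounded_lt (α := Fin l))
      {k | ofX 𝕜 m n (ox.lead (g k)) ∣ sxLead os ox ρ} hred
    obtain ⟨R, a, q, h⟩ := ih _ (key _ fun e he =>
      (hG k).blockLt_of_mem_sxSupport_sub os ox (hg k) hρ ht he) _ rfl
    exact ⟨_, _, _, NFRun.reduce p ρ rfl hρ k t ht (fun k' hlt hdvd => hk k' hdvd hlt) R a q h⟩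
  · obtain ⟨R, a, q, h⟩ := ih _ (key _ fun e he =>
      blockLt_of_mem_sxSupport_sub_sxLead os ox hρ he) _ rfl
    exact ⟨_, _, _, NFRun.keep p ρ rfl hρ (not_exists.1 hred) R a q h⟩

end NFRun

end Runs

/-! ### Convergence of the limit normal form and uniqueness of division. -/

section Limit

variable {𝕜 : Type*} [Field 𝕜] {m n r l : ℕ} {os : LocalDegreeOrder m} {ox : LocalDegreeOrder n}
  {F : Fin r → DiffOp 𝕜 m n} {g : Fin l → MvPowerSeries (Fin n) 𝕜}
  {U : Matrix (Fin r) (Fin l) (MvPowerSeries (Fin n) 𝕜)} {Γ : Finset (Fin n →₀ ℕ)}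

theorem AdicHasSum.mem_sxSupport {u : ℕ → SXRing 𝕜 m n} {v : SXRing 𝕜 m n} (h : AdicHasSum u v)
    {e} (he : e ∈ sxSupport v) : ∃ i, e ∈ sxSupport (u i) := by
  obtain ⟨M, hM⟩ := h (e.1.degree + e.2.degree + 1)
  have h1 := (mem_sxIdeal_pow _ _).1 (hM M le_rfl) e (Nat.lt_succ_self _)
  rw [map_sub, sub_eq_zero, map_sum] at h1
  rw [_root_.mem_sxSupport, h1] at he
  obtain ⟨i, -, hi⟩ := Finset.exists_ne_zero_of_sum_ne_zero he
  exact ⟨i, hi⟩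

theorem AdicHasSum.add {u u' : ℕ → SXRing 𝕜 m n} {v v' : SXRing 𝕜 m n} (h : AdicHasSum u v)
    (h' : AdicHasSum u' v') : AdicHasSum (fun i => u i + u' i) (v + v') := by
  intro d
  obtain ⟨M, hM⟩ := h d
  obtain ⟨M', hM'⟩ := h' d
  refine ⟨max M M', fun k hk => ?_⟩
  rw [Finset.sum_add_distrib, add_sub_add_comm]
  exact add_mem (hM k (le_of_max_le_left hk)) (hM' k (le_of_max_le_right hk))

theorem adicHasSum_zero : AdicHasSum (fun _ => (0 : SXRing 𝕜 m n)) 0 :=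
  fun _ => ⟨0, fun _ _ => by simp⟩

theorem AdicHasSum.finset_sum {ι : Type*} (s : Finset ι) {u : ι → ℕ → SXRing 𝕜 m n}
    {v : ι → SXRing 𝕜 m n} (h : ∀ i ∈ s, AdicHasSum (u i) (v i)) :
    AdicHasSum (fun k => ∑ i ∈ s, u i k) (∑ i ∈ s, v i) := by
  classical
  induction s using Finset.induction_on with
  | empty => simpa using adicHasSum_zero
  | insert i s hi ih =>
    simp only [Finset.sum_insert hi]
    exact (h i (Finset.mem_insert_self i s)).add
      (ih fun j hj => h j (Finset.mem_insert_of_mem hj))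

/-- Along the limit normal form all data of the individual runs tend to zero. -/
theorem eventually_mem_sxIdeal_pow (hg : ∀ k, g k ≠ 0)
    (hG : ∀ k, IsPerturbation Γ (g k) (partialBasis F U k)) {N : ℤ → ℚ} {K : ℕ → ℤ}
    (hK : ∀ x : ℚ, ∃ M, ∀ i ≥ M, (K i : ℚ) ≤ x) (hN : ∀ x : ℚ, ∃ M, ∀ i ≥ M, N (K i) ≤ x)
    {P Rs : ℕ → SXRing 𝕜 m n} {as : ℕ → Fin l → SXRing 𝕜 m n}
    (h : ∀ i, NFRun os ox F g U N (K i) (P i) (Rs i) (as i) (P (i + 1))) (d : ℕ) :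
    ∃ M, ∀ i ≥ M, P i ∈ sxIdeal 𝕜 m n ^ d ∧ Rs i ∈ sxIdeal 𝕜 m n ^ d ∧
      ∀ k, as i k ∈ sxIdeal 𝕜 m n ^ d := by
  obtain ⟨w, hw, hdeg⟩ := os.exists_neg_mul_degree_le_deg
  -- The summand `w` converts a bound on the total degree into one on the degree in `x`; the other
  -- two pay for derivatives and for division by `lead(g_k)`.
  let C : ℚ := w + ∑ γ ∈ Γ, -ox.deg γ + ∑ k, -ox.deg (ox.lexp (g k))
  have hΓ0 : ∀ γ ∈ Γ, -ox.deg γ ≤ ∑ γ ∈ Γ, -ox.deg γ := fun γ hγ =>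
    Finset.single_le_sum (f := fun γ => -ox.deg γ) (fun γ _ => by linarith [ox.deg_nonpos γ]) hγ
  have hg0 : ∀ k, -ox.deg (ox.lexp (g k)) ≤ ∑ k, -ox.deg (ox.lexp (g k)) := fun k =>
    Finset.single_le_sum (f := fun k => -ox.deg (ox.lexp (g k)))
      (fun k _ => by linarith [ox.deg_nonpos (ox.lexp (g k))]) (Finset.mem_univ k)
  have hΓ1 : 0 ≤ ∑ γ ∈ Γ, -ox.deg γ :=
    Finset.sum_nonneg fun γ _ => by linarith [ox.deg_nonpos γ]
  have hg1 : 0 ≤ ∑ k, -ox.deg (ox.lexp (g k)) :=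
    Finset.sum_nonneg fun k _ => by linarith [ox.deg_nonpos (ox.lexp (g k))]
  have hC : 0 < C := by simp only [C]; linarith
  obtain ⟨x, hx⟩ := exists_slopeBound_imp_mem_sxIdeal_pow (𝕜 := 𝕜) (m := m) ox hC.le d
  obtain ⟨M₁, hM₁⟩ := hK ((x - C) / C)
  obtain ⟨M₂, hM₂⟩ := hN (x - C)
  refine ⟨max M₁ M₂ + 1, fun i hi => ?_⟩
  -- The bound on `P (i + 1)` comes from the call with `K i` that returned it. Starting from `δ = x
  -- - C` leaves room for the loss `C` in the quotients.
  obtain ⟨i, rfl⟩ : ∃ i', i = i' + 1 := ⟨i - 1, by omega⟩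
  have hKi := hM₁ i (le_of_max_le_left (Nat.succ_le_succ_iff.1 hi))
  have hNi := hM₂ i (le_of_max_le_right (Nat.succ_le_succ_iff.1 hi))
  rw [le_div_iff₀ hC] at hKi
  have hP : SlopeBound ox C (x - C) (P (i + 1)) := by
    intro e he
    rcases (h i).le_degree_or_deg_lt e he with h1 | h1
    · have h2 : (-(K i) : ℚ) ≤ e.1.degree := by exact_mod_cast Int.toNat_le.1 h1
      have := ox.deg_nonpos e.2
      nlinarith
    · have h2 := hdeg e.1
      have h3 : w * e.1.degree ≤ C * e.1.degree :=
        mul_le_mul_of_nonneg_right (by simp only [C]; linarith) (Nat.cast_nonneg _)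
      linarith
  obtain ⟨h1, h2, -⟩ := (h (i + 1)).slopeBound hg hG hC.le
    (fun γ hγ k => by have := hΓ0 γ hγ; have := hg0 k; simp only [C]; linarith)
    (fun k => by have := hg0 k; simp only [C]; linarith) hP
  exact ⟨hx _ (by linarith) _ hP, hx _ (by linarith) _ h1, fun k => hx _ (by linarith) _ (h2 k)⟩

theorem exists_limitNF (hg : ∀ k, g k ≠ 0)
    (hG : ∀ k, IsPerturbation Γ (g k) (partialBasis F U k)) {N : ℤ → ℚ} {K : ℕ → ℤ}
    (hK : ∀ x : ℚ, ∃ M, ∀ i ≥ M, (K i : ℚ) ≤ x) (hN : ∀ x : ℚ, ∃ M, ∀ i ≥ M, N (K i) ≤ x)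
    (p : SXRing 𝕜 m n) : ∃ R a, LimitNF os ox F g U N K p R a := by
  choose R a q hrun using NFRun.exists_run os ox hg hG N
  let P : ℕ → SXRing 𝕜 m n := fun i => Nat.rec p (fun i p' => q (K i) p') i
  have h : ∀ i, NFRun os ox F g U N (K i) (P i) (R (K i) (P i)) (a (K i) (P i)) (P (i + 1)) :=
    fun i => hrun (K i) (P i)
  have hlim := eventually_mem_sxIdeal_pow hg hG hK hN h
  obtain ⟨R', hR'⟩ := exists_adicHasSum (u := fun i => R (K i) (P i)) fun d =>
    (hlim d).imp fun M hM i hi => (hM i hi).2.1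
  have ha : ∀ k, ∃ v, AdicHasSum (fun i => a (K i) (P i) k) v := fun k =>
    exists_adicHasSum fun d => (hlim d).imp fun M hM i hi => (hM i hi).2.2 k
  choose a' ha' using ha
  exact ⟨R', a', P, _, _, rfl, h, hR', ha'⟩

namespace LimitNF

variable {N : ℤ → ℚ} {K : ℕ → ℤ} {p R : SXRing 𝕜 m n} {a : Fin l → SXRing 𝕜 m n}

theorem mem_divisionPairs (hg : ∀ k, g k ≠ 0) (h : LimitNF os ox F g U N K p R a) :
    (a, R) ∈ divisionPairs m ox g := by
  obtain ⟨P, Rs, as, -, hrun, hR, ha⟩ := h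
  refine ⟨fun k e he => ?_, fun e he => ?_⟩
  · obtain ⟨i, hi⟩ := (ha k).mem_sxSupport he
    exact ((hrun i).mem_divisionPairs hg).1 k e hi
  · obtain ⟨i, hi⟩ := hR.mem_sxSupport he
    exact ((hrun i).mem_divisionPairs hg).2 e hi

theorem eq_add (hg : ∀ k, g k ≠ 0) (hG : ∀ k, IsPerturbation Γ (g k) (partialBasis F U k))
    (hK : ∀ x : ℚ, ∃ M, ∀ i ≥ M, (K i : ℚ) ≤ x) (hN : ∀ x : ℚ, ∃ M, ∀ i ≥ M, N (K i) ≤ x)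
    (h : LimitNF os ox F g U N K p R a) : ∑ k, partialBasis F U k (a k) + R = p := by
  obtain ⟨P, Rs, as, rfl, hrun, hR, ha⟩ := h
  have hsum : AdicHasSum (fun i => ∑ k, partialBasis F U k (as i k) + Rs i)
      (∑ k, partialBasis F U k (a k) + R) :=
    (AdicHasSum.finset_sum _ fun k _ => (hG k).adicHasSum_map (ha k)).add hR
  have htel : ∀ M, ∑ i ∈ Finset.range M, (∑ k, partialBasis F U k (as i k) + Rs i) =
      P 0 - P M := by
    intro M
    rw [← Finset.sum_range_sub']
    refine Finset.sum_congr rfl fun i _ => ?_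
    rw [(hrun i).eq_add_add]
    abel
  rw [← sub_eq_zero]
  refine eq_zero_of_forall_mem_sxIdeal_pow fun d => ?_
  obtain ⟨M, hM⟩ := hsum d
  obtain ⟨M', hM'⟩ := eventually_mem_sxIdeal_pow hg hG hK hN hrun d
  have h1 := hM _ (le_max_left M M')
  rw [htel] at h1
  have h2 := sub_mem h1 (hM' _ (le_max_right M M')).1
  convert h2 using 1
  abel

end LimitNF

/-- The `𝕜[[s]]`-linear map `(a, R) ↦ ∑ G_k a_k + R`. -/
noncomputable def divisionMap (F : Fin r → DiffOp 𝕜 m n)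
    (U : Matrix (Fin r) (Fin l) (MvPowerSeries (Fin n) 𝕜)) :
    ((Fin l → SXRing 𝕜 m n) × SXRing 𝕜 m n) →ₗ[SRing 𝕜 m] SXRing 𝕜 m n :=
  (∑ k, partialBasis F U k ∘ₗ LinearMap.proj k) ∘ₗ LinearMap.fst _ _ _ + LinearMap.snd _ _ _

theorem divisionMap_apply (x : (Fin l → SXRing 𝕜 m n) × SXRing 𝕜 m n) :
    divisionMap F U x = ∑ k, partialBasis F U k (x.1 k) + x.2 := by
  simp [divisionMap]

/-- Take the greatest monomial `e` among those of all `lead(g_k) a_k` and of `R`. Exactly one of the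
summands `G_k a_k` and `R` has a nonzero coefficient there, so the sum cannot vanish. -/
theorem eq_zero_of_divisionMap_eq_zero (os : LocalDegreeOrder m) (hg : ∀ k, g k ≠ 0)
    (hG : ∀ k, IsPerturbation Γ (g k) (partialBasis F U k))
    {x : (Fin l → SXRing 𝕜 m n) × SXRing 𝕜 m n} (hx : x ∈ divisionPairs m ox g)
    (h0 : divisionMap F U x = 0) : x = 0 := by
  let S : Set ((Fin m →₀ ℕ) × (Fin n →₀ ℕ)) :=
    {e | (∃ k, ∃ w ∈ sxSupport (x.1 k), (w.1, ox.lexp (g k) + w.2) = e) ∨ e ∈ sxSupport x.2}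
  by_contra hne
  have hS : S.Nonempty := by
    by_contra hS
    rw [Set.not_nonempty_iff_eq_empty, Set.eq_empty_iff_forall_notMem] at hS
    refine hne (Prod.ext (funext fun k => ?_) ?_)
    · by_contra hk
      obtain ⟨w, hw⟩ := exists_sxCoeff_ne_zero hk
      exact hS _ (Or.inl ⟨k, w, hw, rfl⟩)
    · by_contra hk
      obtain ⟨w, hw⟩ := exists_sxCoeff_ne_zero hk
      exact hS _ (Or.inr hw)
  obtain ⟨e, he, hmax⟩ := exists_blockLt_greatest os ox hS
  have hcoeff : ∀ k, sxCoeff e (partialBasis F U k (x.1 k)) = if ox.lexp (g k) ≤ e.2 then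
      MvPowerSeries.coeff (ox.lexp (g k)) (g k) * sxCoeff (e.1, e.2 - ox.lexp (g k)) (x.1 k)
      else 0 := fun k =>
    (hG k).sxCoeff_apply_of_not_blockLt os ox (hg k) fun w hw => hmax _ (Or.inl ⟨k, w, hw, rfl⟩)
  have hzero : ∀ k, sxCoeff e (partialBasis F U k (x.1 k)) ≠ 0 →
      (e.1, e.2 - ox.lexp (g k)) ∈ sxSupport (x.1 k) ∧ ox.lexp (g k) ≤ e.2 := by
    intro k hk
    rw [hcoeff] at hk
    split_ifs at hk with hle
    · exact ⟨right_ne_zero_of_mul hk, hle⟩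
    · exact absurd rfl hk
  have hsum := congrArg (sxCoeff e) h0
  rw [divisionMap_apply, map_add, map_sum, map_zero] at hsum
  rcases he with ⟨k, w, hw, rfl⟩ | he
  · have hk : sxCoeff (w.1, ox.lexp (g k) + w.2) (partialBasis F U k (x.1 k)) ≠ 0 := by
      rw [hcoeff, if_pos le_self_add, add_tsub_cancel_left]
      exact mul_ne_zero (ox.lexp_spec (hg k)).1 hw
    have hR : sxCoeff (w.1, ox.lexp (g k) + w.2) x.2 = 0 := by
      by_contra h
      exact hx.2 _ h k le_self_add
    rw [hR, add_zero, Finset.sum_eq_single k] at hsum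
    · exact hk hsum
    · intro k' _ hkk
      by_contra h
      obtain ⟨h1, h2⟩ := hzero k' h
      simp only at h1 h2
      -- If two indices contributed at `e`, the leading monomial of the smaller one would divide a
      -- term belonging to the larger one, which the division conditions forbid.
      rcases lt_or_gt_of_ne hkk with hlt | hlt
      · exact hx.1 k w hw k' hlt h2
      · refine hx.1 k' _ h1 k hlt ?_
        simp only [add_tsub_cancel_of_le h2]
        exact le_self_add
    · simp
  · rw [Finset.sum_eq_zero, zero_add] at hsum
    · exact he hsum
    · intro k _
      by_contra h
      exact hx.2 e he k (hzero k h).2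

end Limit

/-- Projectivity splits `φ`, so the kernel is the image of a projector `pr` of `M` and is finitely
generated. Applying `pr` to `ker φ ≤ 𝔪 M` gives `ker φ ≤ 𝔪 ker φ`, and Nakayama's lemma applies. -/
theorem LinearMap.injective_of_ker_le_maximalIdeal_smul {R M H : Type*} [CommRing R] [IsLocalRing R]
    [AddCommGroup M] [Module R M] [Module.Finite R M] [AddCommGroup H] [Module R H]
    [Module.Projective R H] (φ : M →ₗ[R] H) (hφ : Function.Surjective φ)
    (hker : LinearMap.ker φ ≤ IsLocalRing.maximalIdeal R • (⊤ : Submodule R M)) :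
    Function.Injective φ := by
  obtain ⟨s, hs⟩ := Module.projective_lifting_property φ LinearMap.id hφ
  have hs' : ∀ h, φ (s h) = h := LinearMap.congr_fun hs
  let pr : M →ₗ[R] M := LinearMap.id - s ∘ₗ φ
  have hrange : Submodule.map pr ⊤ = LinearMap.ker φ := by
    refine le_antisymm ?_ fun x hx => ⟨x, trivial, ?_⟩
    · rintro _ ⟨x, -, rfl⟩
      simp [pr, hs']
    · simp [pr, LinearMap.mem_ker.1 hx]
  rw [← LinearMap.ker_eq_bot]
  refine Submodule.eq_bot_of_le_smul_of_le_jacobson_bot (IsLocalRing.maximalIdeal R) _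
    (hrange ▸ Module.Finite.fg_top.map pr) (fun x hx => ?_) (IsLocalRing.maximalIdeal_le_jacobson _)
  have h := Submodule.mem_map_of_mem (f := pr) (hker hx)
  rw [Submodule.map_smul'', hrange] at h
  simpa [pr, LinearMap.mem_ker.1 hx] using h

/-! ### Standard monomials over `𝕜[[x]]`. -/

section StandardMonomials

variable {𝕜 : Type*} [Field 𝕜] {n r l : ℕ} {ox : LocalDegreeOrder n}
  {g : Fin l → MvPowerSeries (Fin n) 𝕜}

theorem exists_lexp_le_of_mem_span_lead {p : MvPowerSeries (Fin n) 𝕜}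
    (hp : p ∈ Ideal.span (Set.range fun k => ox.lead (g k))) {b}
    (hb : MvPowerSeries.coeff b p ≠ 0) : ∃ k, ox.lexp (g k) ≤ b := by
  classical
  obtain ⟨c, rfl⟩ := (Ideal.mem_span_range_iff_exists_fun).1 hp
  rw [map_sum] at hb
  obtain ⟨k, -, hk⟩ := Finset.exists_ne_zero_of_sum_ne_zero hb
  refine ⟨k, ?_⟩
  rw [LocalDegreeOrder.lead, MvPowerSeries.coeff_mul_monomial] at hk
  by_contra h
  exact hk (if_neg h)

theorem mem_stdExponents_iff (hg : ∀ k, g k ≠ 0) {b : Fin n →₀ ℕ} :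
    b ∈ stdExponents ox g ↔ ∀ k, ¬ ox.lexp (g k) ≤ b := by
  constructor
  · intro hb k hk
    refine hb ?_
    have h : MvPowerSeries.monomial b (1 : 𝕜) =
        MvPowerSeries.monomial (b - ox.lexp (g k)) (MvPowerSeries.coeff (ox.lexp (g k)) (g k))⁻¹ *
          ox.lead (g k) := by
      rw [LocalDegreeOrder.lead, MvPowerSeries.monomial_mul_monomial, tsub_add_cancel_of_le hk,
        inv_mul_cancel₀ (ox.lexp_spec (hg k)).1]
    rw [h]
    exact Ideal.mul_mem_left _ _ (Ideal.subset_span ⟨k, rfl⟩)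
  · intro h hb
    obtain ⟨k, hk⟩ := exists_lexp_le_of_mem_span_lead hb
      (by rw [MvPowerSeries.coeff_monomial_same]; exact one_ne_zero)
    exact h k hk

theorem monomial_mem_span_X_pow {k : ℕ} {b : Fin n →₀ ℕ} (h : k ≤ b.degree) :
    MvPowerSeries.monomial b (1 : 𝕜) ∈
      Ideal.span (Set.range (MvPowerSeries.X (σ := Fin n) (R := 𝕜))) ^ k := by
  induction k generalizing b with
  | zero => simp
  | succ k ih =>
    obtain ⟨i, hi⟩ := exists_single_le_of_degree_ne_zero (a := b) (by omega)
    have hdeg : (b - Finsupp.single i 1).degree + 1 = b.degree := by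
      conv_rhs => rw [← tsub_add_cancel_of_le hi, map_add, Finsupp.degree_single]
    rw [← tsub_add_cancel_of_le hi, ← one_mul (1 : 𝕜), ← MvPowerSeries.monomial_mul_monomial,
      pow_succ]
    exact Ideal.mul_mem_mul (ih (by omega)) (Ideal.subset_span ⟨i, rfl⟩)

theorem lead_monomial (b : Fin n →₀ ℕ) :
    ox.lead (MvPowerSeries.monomial b (1 : 𝕜)) = MvPowerSeries.monomial b 1 := by
  have hne : MvPowerSeries.monomial b (1 : 𝕜) ≠ 0 := fun h => by
    have := congrArg (MvPowerSeries.coeff b) h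
    simp at this
  have h : ox.lexp (MvPowerSeries.monomial b (1 : 𝕜)) = b :=
    MvPowerSeries.eq_of_coeff_monomial_ne_zero (ox.lexp_spec hne).1
  rw [LocalDegreeOrder.lead, h, MvPowerSeries.coeff_monomial_same]

theorem IsStandardBasis.exists_lexp_le {I : Ideal (MvPowerSeries (Fin n) 𝕜)}
    (hg : IsStandardBasis ox I g) {p : MvPowerSeries (Fin n) 𝕜} (hp : p ∈ I) (hp0 : p ≠ 0) :
    ∃ k, ox.lexp (g k) ≤ ox.lexp p := by
  have h : ox.lead p ∈ Ideal.span (ox.lead '' (I : Set (MvPowerSeries (Fin n) 𝕜))) :=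
    Ideal.subset_span ⟨p, hp, rfl⟩
  rw [hg.2.2] at h
  refine exists_lexp_le_of_mem_span_lead h ?_
  rw [LocalDegreeOrder.lead, MvPowerSeries.coeff_monomial_same]
  exact (ox.lexp_spec hp0).1

theorem IsStandardBasis.finite_stdExponents {I : Ideal (MvPowerSeries (Fin n) 𝕜)}
    (hg : IsStandardBasis ox I g)
    (hfin : ∃ k : ℕ, Ideal.span (Set.range (MvPowerSeries.X (σ := Fin n) (R := 𝕜))) ^ k ≤ I) :
    (stdExponents ox g).Finite := by
  obtain ⟨k, hk⟩ := hfin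
  refine (Set.finite_Iic (Finsupp.equivFunOnFinite.symm fun _ => k)).subset fun b hb i => ?_
  have hlt : b.degree < k := by
    by_contra! hle
    refine hb ?_
    rw [← hg.2.2]
    exact Ideal.subset_span ⟨_, hk (monomial_mem_span_X_pow hle), lead_monomial b⟩
  exact (Finsupp.le_degree i b).trans hlt.le

end StandardMonomials

/-! ### The span of the standard monomials and specialization at `s = 0`. -/

section MonomialSpan

variable {𝕜 : Type*} [Field 𝕜] {m n r l : ℕ} {ox : LocalDegreeOrder n}
  {g : Fin l → MvPowerSeries (Fin n) 𝕜}

open scoped Classical in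
theorem coeff_xMonomial (b b' : Fin n →₀ ℕ) :
    MvPowerSeries.coeff b' (xMonomial 𝕜 m b) = if b' = b then 1 else 0 :=
  MvPowerSeries.coeff_monomial _ _ _

/-- Finiteness of the monomial family makes every series supported on it a finite
`𝕜[[s]]`-combination. -/
theorem mem_monomialSpan_iff (hg : ∀ k, g k ≠ 0) (hfin : (stdExponents ox g).Finite)
    {p : SXRing 𝕜 m n} : p ∈ monomialSpan m ox g ↔ (0, p) ∈ divisionPairs m ox g := by
  classical
  constructor
  · suffices h : monomialSpan m ox g ≤ (divisionPairs m ox g).comap (LinearMap.inr _ _ _) from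
      fun hp => h hp
    refine Submodule.span_le.2 ?_
    rintro _ ⟨b, hb, rfl⟩
    refine ⟨fun k e he => absurd he (notMem_sxSupport_zero e), fun e he => ?_⟩
    have he' : sxCoeff e (xMonomial 𝕜 m b) ≠ 0 := he
    rw [sxCoeff_apply, coeff_xMonomial] at he'
    split_ifs at he' with h
    · rw [h]
      exact (mem_stdExponents_iff hg).1 hb
    · exact absurd (map_zero _) he'
  · intro hp
    have h : p = ∑ b ∈ hfin.toFinset, MvPowerSeries.coeff b p • xMonomial 𝕜 m b := by
      refine MvPowerSeries.ext fun b => ?_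
      simp only [map_sum, MvPowerSeries.coeff_smul, coeff_xMonomial, mul_ite, mul_one, mul_zero,
        Finset.sum_ite_eq, Set.Finite.mem_toFinset]
      split_ifs with hb
      · rfl
      · refine MvPowerSeries.ext fun a => ?_
        by_contra hne
        exact hb ((mem_stdExponents_iff hg).2 (hp.2 (a, b) hne))
    rw [h]
    exact Submodule.sum_mem _ fun b hb => Submodule.smul_mem _ _
      (Submodule.subset_span ⟨b, hfin.mem_toFinset.1 hb, rfl⟩)

/-- The specialization `𝕜[[s,x]] → 𝕜[[x]]` at `s = 0`. -/
noncomputable def specialize (𝕜 : Type*) [Field 𝕜] (m n : ℕ) :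
    SXRing 𝕜 m n →+* MvPowerSeries (Fin n) 𝕜 :=
  MvPowerSeries.map MvPowerSeries.constantCoeff

theorem specialize_familyMap {F : Fin r → DiffOp 𝕜 m n} {f : Fin r → MvPowerSeries (Fin n) 𝕜}
    {D : Fin m → Fin r → DiffOp 𝕜 m n}
    (hF : ∀ i, F i = DiffOp.ofSeries m (f i) - ∑ j, sVar 𝕜 m n j • D j i)
    (q : Fin r → SXRing 𝕜 m n) :
    specialize 𝕜 m n (familyMap F q) ∈ Ideal.span (Set.range f) := by
  have hX : ∀ p, specialize 𝕜 m n (ofX 𝕜 m n p) = p := fun p => by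
    rw [specialize, ofX, MvPowerSeries.map_map, MvPowerSeries.constantCoeff_comp_C,
      MvPowerSeries.map_id, RingHom.id_apply]
  have hs : ∀ j, specialize 𝕜 m n (sVar 𝕜 m n j) = 0 := fun j => by
    rw [specialize, sVar, MvPowerSeries.map_C, MvPowerSeries.constantCoeff_X, map_zero]
  rw [familyMap, LinearMap.sum_apply, map_sum]
  refine Submodule.sum_mem _ fun i _ => ?_
  rw [LinearMap.comp_apply, LinearMap.proj_apply, act_family_apply (hF i), map_sub, map_mul, hX,
    map_sum, Finset.sum_eq_zero fun j _ => by rw [map_mul, hs, zero_mul], sub_zero]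
  exact Ideal.mul_mem_right _ _ (Ideal.subset_span ⟨i, rfl⟩)

open scoped Classical in
theorem coeff_linearCombination_xMonomial (c : stdExponents ox g →₀ SRing 𝕜 m) (b : Fin n →₀ ℕ) :
    MvPowerSeries.coeff b (Finsupp.linearCombination (SRing 𝕜 m)
      (fun b : stdExponents ox g => xMonomial 𝕜 m b.1) c) =
      if h : b ∈ stdExponents ox g then c ⟨b, h⟩ else 0 := by
  rw [Finsupp.linearCombination_apply, Finsupp.sum, map_sum]
  simp only [MvPowerSeries.coeff_smul, coeff_xMonomial, mul_ite, mul_one, mul_zero]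
  split_ifs with h
  · rw [Finset.sum_eq_single ⟨b, h⟩]
    · simp
    · intro b' _ hne
      exact if_neg fun h' => hne (Subtype.ext h'.symm)
    · intro hc
      rw [if_pos rfl, Finsupp.notMem_support_iff.1 hc]
  · exact Finset.sum_eq_zero fun b' _ => if_neg fun h' => h (by rw [h']; exact b'.2)

/-- A relation between the classes of the standard monomials in the cokernel has its coefficients
in the maximal ideal of `𝕜[[s]]`. -/
theorem constantCoeff_eq_zero_of_mem_range {F : Fin r → DiffOp 𝕜 m n}
    {f : Fin r → MvPowerSeries (Fin n) 𝕜} {D : Fin m → Fin r → DiffOp 𝕜 m n}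
    (hF : ∀ i, F i = DiffOp.ofSeries m (f i) - ∑ j, sVar 𝕜 m n j • D j i)
    (hg : IsStandardBasis ox (Ideal.span (Set.range f)) g) {c : stdExponents ox g →₀ SRing 𝕜 m}
    (hc : Finsupp.linearCombination (SRing 𝕜 m) (fun b : stdExponents ox g => xMonomial 𝕜 m b.1) c ∈
      LinearMap.range (familyMap F)) (b : stdExponents ox g) :
    MvPowerSeries.constantCoeff (c b) = 0 := by
  obtain ⟨q, hq⟩ := hc
  have hmem := specialize_familyMap hF q
  rw [hq] at hmem
  have hcoeff := fun b => congrArg MvPowerSeries.constantCoeff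
    (coeff_linearCombination_xMonomial c b)
  set p := Finsupp.linearCombination (SRing 𝕜 m)
    (fun b : stdExponents ox g => xMonomial 𝕜 m b.1) c
  simp only [← MvPowerSeries.coeff_map] at hcoeff
  change ∀ b, MvPowerSeries.coeff b (specialize 𝕜 m n p) = _ at hcoeff
  -- A nonzero specialization would lie in `⟨f⟩`, so its leading monomial would be divisible by some
  -- `lead(g_k)`, yet all its monomials are standard.
  by_cases hp : specialize 𝕜 m n p = 0
  · have := hcoeff b.1
    rw [hp, map_zero, dif_pos b.2] at this
    exact this.symm
  · obtain ⟨k, hk⟩ := hg.exists_lexp_le hmem hp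
    have h := (ox.lexp_spec hp).1
    rw [hcoeff] at h
    split_ifs at h with h'
    · exact absurd hk ((mem_stdExponents_iff hg.1).1 h' k)
    · exact absurd (map_zero _) h

end MonomialSpan

/-! ### The degree bounds tend to -∞; the proposition. -/

theorem StrictAnti.exists_forall_cast_le {K : ℕ → ℤ} (hK : StrictAnti K) (x : ℚ) :
    ∃ M, ∀ i ≥ M, (K i : ℚ) ≤ x := by
  have h : ∀ i : ℕ, K i ≤ K 0 - i := by
    intro i
    induction i with
    | zero => simp
    | succ i ih =>
      have := hK (Nat.lt_add_one i)
      push_cast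
      omega
  obtain ⟨M, hM⟩ := exists_nat_ge ((K 0 : ℚ) - x)
  refine ⟨M, fun i hi => ?_⟩
  have h1 : (K i : ℚ) ≤ K 0 - i := by exact_mod_cast h i
  have h2 : (M : ℚ) ≤ i := by exact_mod_cast hi
  linarith

theorem exists_forall_degBound_le {𝕜 : Type*} [Field 𝕜] {m n r : ℕ} [NeZero m] [NeZero n]
    (os : LocalDegreeOrder m) (ox : LocalDegreeOrder n) (D : Fin m → Fin r → DiffOp 𝕜 m n)
    {K : ℕ → ℤ} (hK : StrictAnti K) (x : ℚ) : ∃ M, ∀ i ≥ M, degBound os ox D (K i) ≤ x := by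
  have hw : os.minWt < 0 := by
    obtain ⟨i, -, hi⟩ := Finset.exists_mem_eq_inf' Finset.univ_nonempty os.wt
    rw [LocalDegreeOrder.minWt, hi]
    exact os.wt_neg i
  set c := -ox.minWt + greatest (· < ·) (⋃ j, ⋃ k, (D j k).degrees os ox) with hc
  obtain ⟨M, hM⟩ := hK.exists_forall_cast_le ((c - x) / os.minWt)
  refine ⟨M, fun i hi => ?_⟩
  have h := hM i hi
  rw [le_div_iff_of_neg hw] at h
  rw [degBound]
  linarith

theorem mainTheorem1 {𝕜 : Type*} [Field 𝕜] {m n r l : ℕ} [NeZero m] [NeZero n]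
    -- the formal family `F = f - s D` with specialization `f` at `s = 0`
    (F : Fin r → DiffOp 𝕜 m n) (f : Fin r → MvPowerSeries (Fin n) 𝕜)
    (D : Fin m → Fin r → DiffOp 𝕜 m n)
    (hF : ∀ i, F i = DiffOp.ofSeries m (f i) - ∑ j, sVar 𝕜 m n j • D j i)
    (hfin : ∃ k : ℕ, Ideal.span (Set.range (MvPowerSeries.X (σ := Fin n) (R := 𝕜))) ^ k ≤
      Ideal.span (Set.range f))
    -- the standard basis `g = f U` of `⟨f⟩`
    (ox : LocalDegreeOrder n) (g : Fin l → MvPowerSeries (Fin n) 𝕜)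
    (hg : IsStandardBasis ox (Ideal.span (Set.range f)) g)
    (U : Matrix (Fin r) (Fin l) (MvPowerSeries (Fin n) 𝕜))
    (hU : ∀ k, g k = ∑ i, f i * U i k)
    -- the ordering on the monomials in `s`
    (os : LocalDegreeOrder m) (hdeg : DegreeCondition os ox g D)
    -- the sequence that defines the limit normal form
    (K : ℕ → ℤ) (hK0 : ∀ i, K i ≤ 0) (hK : StrictAnti K) :
    ∃ NF₁ : SXRing 𝕜 m n →ₗ[SRing 𝕜 m] SXRing 𝕜 m n,
      -- the limit normal form exists, is unique, and its first component is the map `NF₁`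
      (∀ p, ∃! Ra : SXRing 𝕜 m n × (Fin l → SXRing 𝕜 m n),
        LimitNF os ox F g U (degBound os ox D) K p Ra.1 Ra.2) ∧
      (∀ p R a, LimitNF os ox F g U (degBound os ox D) K p R a → NF₁ p = R) ∧
      -- `NF₁` is an idempotent map onto `⟨m⟩𝕜[[s]]`
      LinearMap.range NF₁ = monomialSpan m ox g ∧
      NF₁ ∘ₗ NF₁ = NF₁ ∧
      -- it is compatible with `π_H`, which is onto `H` on both modules
      cokerProj F ∘ₗ NF₁ = cokerProj F ∧
      Function.Surjective (cokerProj F) ∧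
      Submodule.map (cokerProj F) (monomialSpan m ox g) = ⊤ ∧
      -- if `H` is free, `NF₁` induces a section of `π_H`: the representation in the basis `m`
      (Module.Free (SRing 𝕜 m) (Coker F) →
        ∃ σ : Coker F →ₗ[SRing 𝕜 m] SXRing 𝕜 m n,
          σ ∘ₗ cokerProj F = NF₁ ∧
          cokerProj F ∘ₗ σ = LinearMap.id ∧
          LinearMap.range σ = monomialSpan m ox g ∧
          ∃ B : Module.Basis (stdExponents ox g) (SRing 𝕜 m) (Coker F),
            (∀ b, B b = cokerProj F (xMonomial 𝕜 m b.1)) ∧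
            ∀ h, σ h = (B.repr h).sum fun b c => c • xMonomial 𝕜 m b.1) := by
  have hfin' := hg.finite_stdExponents hfin
  obtain ⟨Γ, hG⟩ := isPerturbation_partialBasis hF hU
  have hKlim := hK.exists_forall_cast_le
  have hNlim := exists_forall_degBound_le os ox D hK
  -- `Φ` is linear by construction, and every limit normal form is a preimage under it. Uniqueness
  -- and linearity of the normal form are thus read off from `Φ⁻¹`.
  let Φ := (divisionMap F U).domRestrict (divisionPairs m ox g)
  have hinj : Function.Injective Φ := (injective_iff_map_eq_zero Φ).2 fun x hx =>
    Subtype.ext (eq_zero_of_divisionMap_eq_zero os hg.1 hG x.2 hx)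
  have hlim : ∀ {p R a}, LimitNF os ox F g U (degBound os ox D) K p R a →
      ∃ h : (a, R) ∈ divisionPairs m ox g, Φ ⟨(a, R), h⟩ = p := fun h =>
    ⟨h.mem_divisionPairs hg.1, (divisionMap_apply _).trans (h.eq_add hg.1 hG hKlim hNlim)⟩
  have hex := exists_limitNF (os := os) (ox := ox) hg.1 hG hKlim hNlim
  have hsurj : Function.Surjective Φ := fun p => by
    obtain ⟨R, a, h⟩ := hex p
    exact ⟨_, (hlim h).2⟩
  let E := LinearEquiv.ofBijective Φ ⟨hinj, hsurj⟩
  let NF₁ : SXRing 𝕜 m n →ₗ[SRing 𝕜 m] SXRing 𝕜 m n :=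
    LinearMap.snd _ _ _ ∘ₗ (divisionPairs m ox g).subtype ∘ₗ E.symm.toLinearMap
  have hNF : ∀ x, NF₁ (Φ x) = x.1.2 := fun x =>
    congrArg (fun y => y.1.2) (E.symm_apply_apply x)
  have hmem : ∀ p, NF₁ p ∈ monomialSpan m ox g := fun p => by
    obtain ⟨x, rfl⟩ := hsurj p
    rw [hNF, mem_monomialSpan_iff hg.1 hfin']
    exact ⟨fun k e he => absurd he (notMem_sxSupport_zero e), x.2.2⟩
  have hfix : ∀ p ∈ monomialSpan m ox g, NF₁ p = p := fun p hp => by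
    have h : Φ ⟨_, (mem_monomialSpan_iff hg.1 hfin').1 hp⟩ = p := by
      refine (divisionMap_apply _).trans ?_
      simp
    conv_lhs => rw [← h]
    exact hNF _
  have hproj : ∀ p, cokerProj F (NF₁ p) = cokerProj F p := fun p => by
    obtain ⟨x, rfl⟩ := hsurj p
    rw [hNF, eq_comm, ← sub_eq_zero, ← map_sub]
    refine (Submodule.Quotient.mk_eq_zero _).2 ?_
    rw [show Φ x = ∑ k, partialBasis F U k (x.1.1 k) + x.1.2 from divisionMap_apply _,
      add_sub_cancel_right]
    exact Submodule.sum_mem _ fun k _ => partialBasis_mem_range F U k _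
  have hrange : LinearMap.range NF₁ = monomialSpan m ox g := le_antisymm
    (by rintro _ ⟨p, rfl⟩; exact hmem p) fun p hp => ⟨p, hfix p hp⟩
  have hπ : Function.Surjective (cokerProj F) := Submodule.mkQ_surjective _
  have hmap : Submodule.map (cokerProj F) (monomialSpan m ox g) = ⊤ := by
    rw [eq_top_iff]
    intro h _
    obtain ⟨p, rfl⟩ := hπ h
    exact ⟨NF₁ p, hmem p, hproj p⟩
  refine ⟨NF₁, fun p => ?_, fun p R a h => ?_, hrange, LinearMap.ext fun p => hfix _ (hmem p),
    LinearMap.ext hproj, hπ, hmap, fun hfree => ?_⟩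
  · obtain ⟨R, a, h⟩ := hex p
    refine ⟨(R, a), h, fun Ra h' => ?_⟩
    have := congrArg Subtype.val (hinj ((hlim h').2.trans (hlim h).2.symm))
    exact Prod.ext (congrArg Prod.snd this) (congrArg Prod.fst this)
  · obtain ⟨hx, rfl⟩ := hlim h
    exact hNF _
  · have : Finite (stdExponents ox g) := hfin'
    let ψ := Finsupp.linearCombination (SRing 𝕜 m)
      fun b : stdExponents ox g => xMonomial 𝕜 m b.1
    have hψ : LinearMap.range ψ = monomialSpan m ox g := by
      rw [Finsupp.range_linearCombination, monomialSpan, Set.image_eq_range]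
    have hφsurj : Function.Surjective (cokerProj F ∘ₗ ψ) := by
      rw [← LinearMap.range_eq_top, LinearMap.range_comp, hψ, hmap]
    have hφinj : Function.Injective (cokerProj F ∘ₗ ψ) := by
      refine LinearMap.injective_of_ker_le_maximalIdeal_smul _ hφsurj fun c hc => ?_
      have hc0 := constantCoeff_eq_zero_of_mem_range hF hg
        ((Submodule.Quotient.mk_eq_zero _).1 (LinearMap.mem_ker.1 hc))
      rw [← Finsupp.sum_single c]
      refine Submodule.sum_mem _ fun b _ => ?_
      rw [← mul_one (c b), ← smul_eq_mul, ← Finsupp.smul_single]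
      refine Submodule.smul_mem_smul ?_ trivial
      rw [IsLocalRing.mem_maximalIdeal, mem_nonunits_iff]
      intro hu
      have := MvPowerSeries.isUnit_constantCoeff _ hu
      rw [hc0 b] at this
      exact not_isUnit_zero this
    let L := LinearEquiv.ofBijective (cokerProj F ∘ₗ ψ) ⟨hφinj, hφsurj⟩
    have hψmem : ∀ c, ψ c ∈ monomialSpan m ox g := fun c => hψ ▸ LinearMap.mem_range_self ψ c
    -- For `p` in the image of `F`, the normal form is a combination of standard monomials with
    -- class zero in `H`, hence zero by their independence.
    have hker : LinearMap.range (familyMap F) ≤ LinearMap.ker NF₁ := fun p hp => by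
      obtain ⟨c, hc⟩ : NF₁ p ∈ LinearMap.range ψ := hψ ▸ hmem p
      have h0 : (cokerProj F ∘ₗ ψ) c = 0 := by
        rw [LinearMap.comp_apply, hc, hproj]
        exact (Submodule.Quotient.mk_eq_zero _).2 hp
      rw [LinearMap.mem_ker, ← hc, (injective_iff_map_eq_zero _).1 hφinj c h0, map_zero]
    let σ : Coker F →ₗ[SRing 𝕜 m] SXRing 𝕜 m n := (LinearMap.range (familyMap F)).liftQ NF₁ hker
    have hσ : σ ∘ₗ cokerProj F = NF₁ := Submodule.liftQ_mkQ _ _ _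
    refine ⟨σ, hσ, LinearMap.ext fun h => ?_, ?_, Module.Basis.ofRepr L.symm, fun b => ?_,
      fun h => ?_⟩
    · obtain ⟨p, rfl⟩ := hπ h
      exact (congrArg (cokerProj F) (LinearMap.congr_fun hσ p)).trans (hproj p)
    · rw [← hrange, ← hσ, LinearMap.range_comp, LinearMap.range_eq_top.2 hπ, Submodule.map_top]
    · change (cokerProj F ∘ₗ ψ) (Finsupp.single b 1) = _
      simp [ψ]
    · obtain ⟨c, rfl⟩ := L.surjective h
      have h1 : σ (L c) = ψ c := (LinearMap.congr_fun hσ (ψ c)).trans (hfix _ (hψmem c))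
      rw [h1]
      change ψ c = (L.symm (L c)).sum _
      rw [LinearEquiv.symm_apply_apply]
      rfl
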